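/- **Setting.** Let $d\ge 1$ and let $v:[0,\infty)\to\mathbb R\cup\{\infty\}$ be a pair potential with: (1) for some $r_{\rm hc}\ge 0$, $v=\infty$ on $[0,r_{\rm hc}]$ and $v$ is finite on $(r_{\rm hc},\infty)$; (2) $v$ is stable, i.e. with $U_k(x)=\sum_{1\le i<j\le k}v(|x_i-x_j|)$ for $x\in(\mathbb R^d)^k$ the numbers $\frac1k\inf U_k$ are bounded from below; (3) $b:=\sup\operatorname{supp}v<\infty$; (4) $v<0$ on $(b-\delta,b)$ for some $\delta\in(0,b]$; (5) $v$ is continuous on $[r_{\rm hc},\infty)\cap(0,\infty)$ as a map into $\mathbb R\cup\{\infty\}$. Fix $R>b$; a configuration is connected if the graph with an edge between any two particles at distance $\le R$ is connected. For $\beta>0$ and $k\in\mathbb N=\{1,2,\dots\}$ put $$Z_k^{\rm cl}(\beta)=\frac1{k!}\int_{(\mathbb R^d)^{k-1}}e^{-\beta U_k(0,x_2,\dots,x_k)}\mathbf 1\{(0,x_2,\dots,x_k)\text{ connected}\}\,dx_2\cdots dx_k,\qquad f_k^{\rm cl}(\beta)=-\frac1{\beta k}\log Z_k^{\rm cl}(\beta),$$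 and $f^{\rm cl}_\infty(\beta)=\lim_{k\to\infty}f^{\rm cl}_k(\beta)$ (the limit exists). For $\beta,\rho>0$ let $\rho^{\rm ideal}(\beta,\rho)=(\rho_k^{\rm ideal}(\beta,\rho))_{k\in\mathbb N}$ be the minimiser (it exists and is unique) of $$f^{\rm ideal}(\beta,\rho,(\rho_k)_k)=\sum_k k\rho_kf_k^{\rm cl}(\beta)+\Bigl(\rho-\sum_kk\rho_k\Bigr)f_\infty^{\rm cl}(\beta)+\frac1\beta\sum_k\rho_k(\log\rho_k-1)$$ over all sequences with $\rho_k\ge0$ and $\sum_kk\rho_k\le\rho$. Let $E_k=\inf U_k$, $e_\infty=\lim_{k\to\infty}E_k/k$ (the limit exists), $\nu^*=\inf_k(E_k-ke_\infty)$, $\mu(\nu)=\inf_k(E_k-\nu)/k$, and let $\mathcal N\subset[\nu^*,\infty)$ be the set of points at which the piecewise affine map $\mu$ changes its slope. **Hypotheses.** Assume (H1) there is $r_{\rm min}>r_{\rm hc}$ such that $v$ is uniformly Hölder continuous on $[r_{\rm min},\infty)$ and, for every $k$, every minimiser $x$ of $U_k$ satisfies $|x_i-x_j|\ge r_{\rm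 min}$ for $i\ne j$; and (H2) there is $c>0$ such that, for every $k$, every minimiser $x$ of $U_k$ satisfies $|x_i-x_j|\le ck^{1/d}$ for $i\neq j$. **Proposition (cluster size distribution).** Fix $\nu>0$ and put $\rho=e^{-\beta\nu}$. Then, as $\beta\to\infty$: 1. If $\nu\in(\nu^*,\infty)\setminus\mathcal N$, then there is a unique $k_\nu\in\mathbb N$ with $\mu(\nu)=(E_{k_\nu}-\nu)/k_\nu$, the number $\Delta(\nu)=\inf\{\frac{E_k-\nu}{k}-\mu(\nu)\mid k\in\mathbb N,\ k\ne k_\nu\}$ is positive, and $$\frac{k_\nu\,\rho^{\rm ideal}_{k_\nu}(\beta,\rho)}{\rho}=1+O\bigl(e^{-\beta\Delta(\nu)/2}\bigr).$$ 2. If $\nu<\nu^*$, $d\ge2$, each $U_k$ has a minimiser, and in addition (H4) there is $C>0$ such that for all sufficiently large $\beta$ one has $kf_k^{\rm cl}(\beta)-kf_\infty^{\rm cl}(\beta)\ge Ck^{1-1/d}$ for all $k\in\mathbb N$, then $$\sum_{k=1}^\infty\frac{k\,\rho_k^{\rm ideal}(\beta,\rho)}{\rho}=O\bigl(e^{-\beta(\nu^*-\nu)+O(\log\beta)}\bigr).$$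 -/

import Mathlib

open Filter Topology MeasureTheory Asymptotics
open scoped NNReal ENNReal Nat

noncomputable section

namespace IdealMixture

/-- The space `ℝ^d` with its Euclidean norm. -/
abbrev Space (d : ℕ) : Type := EuclideanSpace ℝ (Fin d)

/-- The energy `U_n(x) = ∑_{i<j} v(|x_i - x_j|)` of `n` particles; the pair potential `v` takes
values in `ℝ ∪ {∞}` (the value `⊥` is excluded by `PairPotential.hardcore` and
`PairPotential.finite`). -/
def energy {d : ℕ} (v : ℝ≥0 → EReal) {n : ℕ} (x : Fin n → Space d) : EReal :=
  ∑ i, ∑ j ∈ Finset.Ioi i, v (nndist (x i) (x j))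

/-- The standing assumption on the pair potential `v : [0,∞) → ℝ ∪ {∞}`, with hard core radius
`rhc` and interaction range `b = sup supp v`. -/
structure PairPotential (d : ℕ) (v : ℝ≥0 → EReal) (rhc b : ℝ≥0) : Prop where
  hardcore : ∀ r, r ≤ rhc → v r = ⊤
  finite : ∀ r, rhc < r → v r ≠ ⊤ ∧ v r ≠ ⊥
  /-- stability: `U_n / n` is bounded from below uniformly in `n` and in the configuration -/
  stable : ∃ B : ℝ, ∀ (n : ℕ) (x : Fin n → Space d), ((-(B * n) : ℝ) : EReal) ≤ energy v x
  range : IsLUB {r | v r ≠ 0} b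
  /-- attractive tail: `v < 0` on `(b - δ, b) ⊆ [0, ∞)` -/
  attractive : ∃ δ : ℝ≥0, 0 < δ ∧ δ ≤ b ∧ ∀ r, b - δ < r → r < b → v r < 0
  /-- continuity as a map into `ℝ ∪ {∞}` -/
  continuousOn : ContinuousOn v {r | rhc ≤ r ∧ 0 < r}

/-- `x` is a minimiser of the energy (a ground state). -/
def IsGroundState {d : ℕ} (v : ℝ≥0 → EReal) {n : ℕ} (x : Fin n → Space d) : Prop :=
  ∀ y : Fin n → Space d, energy v x ≤ energy v y

/-- Uniform Hölder continuity away from the hard core, and a uniform lower bound on the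
interparticle distances of ground states. -/
def HolderHypothesis (d : ℕ) (v : ℝ≥0 → EReal) (rhc : ℝ≥0) : Prop :=
  ∃ rmin : ℝ≥0, rhc < rmin ∧
    (∃ C α : ℝ≥0, 0 < α ∧ α ≤ 1 ∧ HolderOnWith C α (fun r => (v r).toReal) (Set.Ici rmin)) ∧
    ∀ (k : ℕ+) (x : Fin k → Space d), IsGroundState v x →
      ∀ i j, i ≠ j → (rmin : ℝ) ≤ dist (x i) (x j)

/-- Ground states have a compact shape. -/
def CompactShapeHypothesis (d : ℕ) (v : ℝ≥0 → EReal) : Prop :=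
  ∃ c : ℝ, 0 < c ∧ ∀ (k : ℕ+) (x : Fin k → Space d), IsGroundState v x →
    ∀ i j, i ≠ j → dist (x i) (x j) ≤ c * (k : ℝ) ^ (1 / (d : ℝ))

/-- A configuration is connected if the graph joining any two distinct particles at
distance `≤ R` is connected. -/
def IsCluster {d : ℕ} (R : ℝ) {n : ℕ} (x : Fin n → Space d) : Prop :=
  (SimpleGraph.fromRel fun i j => dist (x i) (x j) ≤ R).Connected

/-- The Boltzmann weight `exp(-β U(x)) 1{x connected}`; here `exp(-∞) = 0`. -/
def clusterWeight {d : ℕ} (v : ℝ≥0 → EReal) (R β : ℝ) {n : ℕ} (x : Fin n → Space d) : ℝ≥0∞ :=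
  Set.indicator {x | IsCluster R x} (fun x => EReal.exp (-((β : EReal) * energy v x))) x

/-- The cluster partition function `Z_k^cl(β)`: the first particle sits at the origin and the
remaining `k - 1` particles are integrated over `ℝ^d`. -/
def clusterZ (d : ℕ) (v : ℝ≥0 → EReal) (R β : ℝ) (k : ℕ+) : ℝ≥0∞ :=
  ((k : ℕ)! : ℝ≥0∞)⁻¹ *
    ∫⁻ y : Fin k.natPred → Space d,
      clusterWeight v R β (Fin.cons (α := fun _ => Space d) 0 y)

/-- The cluster free energy per particle `f_k^cl(β) = -(βk)⁻¹ log Z_k^cl(β)`. -/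
def clusterF (d : ℕ) (v : ℝ≥0 → EReal) (R β : ℝ) (k : ℕ+) : ℝ :=
  -(1 / (β * k)) * Real.log (clusterZ d v R β k).toReal

/-- `f_∞^cl(β) = lim_{k → ∞} f_k^cl(β)`. -/
def clusterFInf (d : ℕ) (v : ℝ≥0 → EReal) (R β : ℝ) : ℝ :=
  limUnder atTop (clusterF d v R β)

/-- Surface-order correction to the cluster free energy at low temperature. -/
def SurfaceHypothesis (d : ℕ) (v : ℝ≥0 → EReal) (R : ℝ) : Prop :=
  ∃ C : ℝ, 0 < C ∧ ∀ᶠ β : ℝ in atTop, ∀ k : ℕ+,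
    C * (k : ℝ) ^ (1 - 1 / (d : ℝ)) ≤ k * clusterF d v R β k - k * clusterFInf d v R β

/-- The sequences `(ρ_k)_{k ≥ 1}` in `[0,∞)` with `∑ k ρ_k ≤ ρ`. -/
def Admissible (ρ : ℝ) (r : ℕ+ → ℝ) : Prop :=
  (∀ k, 0 ≤ r k) ∧ Summable (fun k : ℕ+ => (k : ℝ) * r k) ∧ ∑' k : ℕ+, (k : ℝ) * r k ≤ ρ

/-- The ideal-mixture rate function. It is only used on admissible sequences, on which all three
series converge absolutely. -/
def idealF (d : ℕ) (v : ℝ≥0 → EReal) (R β ρ : ℝ) (r : ℕ+ → ℝ) : ℝ :=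
  ∑' k : ℕ+, (k : ℝ) * r k * clusterF d v R β k
    + (ρ - ∑' k : ℕ+, (k : ℝ) * r k) * clusterFInf d v R β
    + 1 / β * ∑' k : ℕ+, r k * (Real.log (r k) - 1)

/-- `r` minimises the ideal-mixture rate function among the admissible sequences. -/
def IsIdealMinimiser (d : ℕ) (v : ℝ≥0 → EReal) (R β ρ : ℝ) (r : ℕ+ → ℝ) : Prop :=
  Admissible ρ r ∧ ∀ s, Admissible ρ s → idealF d v R β ρ r ≤ idealF d v R β ρ s

/-- The minimiser `(ρ_k^ideal(β,ρ))_{k ≥ 1}` of the ideal-mixture rate function. -/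
def idealMinimiser (d : ℕ) (v : ℝ≥0 → EReal) (R β ρ : ℝ) : ℕ+ → ℝ :=
  Classical.epsilon (IsIdealMinimiser d v R β ρ)

/-- The ground-state energy `E_k = inf U_k` (a real number for a stable potential). -/
def groundE (d : ℕ) (v : ℝ≥0 → EReal) (k : ℕ+) : ℝ :=
  (⨅ x : Fin k → Space d, energy v x).toReal

/-- `e_∞ = lim_{k → ∞} E_k / k`. -/
def groundEInf (d : ℕ) (v : ℝ≥0 → EReal) : ℝ :=
  limUnder atTop fun k : ℕ+ => groundE d v k / k

/-- `ν* = inf_k (E_k - k e_∞)`. -/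
def nuStar (d : ℕ) (v : ℝ≥0 → EReal) : ℝ :=
  ⨅ k : ℕ+, (groundE d v k - k * groundEInf d v)

/-- `μ(ν) = inf_k (E_k - ν) / k`. -/
def muNu (d : ℕ) (v : ℝ≥0 → EReal) (ν : ℝ) : ℝ :=
  ⨅ k : ℕ+, (groundE d v k - ν) / k

/-- The set of points of `[ν*,∞)` at which the piecewise affine map `μ` changes its slope, i.e.
near which `μ` is not affine. -/
def kinks (d : ℕ) (v : ℝ≥0 → EReal) : Set ℝ :=
  {ν | nuStar d v ≤ ν ∧ ¬ ∃ a c : ℝ, ∀ᶠ t in 𝓝 ν, muNu d v t = a * t + c}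

/-- `Δ(ν) = inf { (E_j - ν)/j - μ(ν) | j ≠ k }`, to be used with `k = k_ν`. -/
def gap (d : ℕ) (v : ℝ≥0 → EReal) (ν : ℝ) (k : ℕ+) : ℝ :=
  ⨅ j : {j : ℕ+ // j ≠ k}, ((groundE d v j.1 - ν) / j.1 - muNu d v ν)

end IdealMixture

end

/-! ### Energies of configurations, ground-state energies and Fekete's lemma -/

namespace IdealMixture

variable {d : ℕ} {v : ℝ≥0 → EReal} {rhc b : ℝ≥0}

/-! The rate function is strictly convex, and its minimiser is explicit: ρ_k = exp(k(a - β(f_k -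
f_∞))) with a multiplier a ≤ 0 of the mass constraint, where a = 0 or ∑ kρ_k = ρ
(`exists_isIdealMinimiser`). Everything else is low-temperature control of f_k and f_∞.

Three estimates are used. (i) `exists_clusterZ_le`: connected configurations have spanning trees,
and counting these gives Z_k ≤ exp(Mk - βE_k) with M independent of β and k; hence k f_k ≥ E_k -
Mk/β uniformly in k. (ii) `eventually_clusterF_le`: for fixed k, a neighbourhood of a connected
near-minimiser gives f_k ≤ E_k/k + ε for large β. (iii) `exists_clusterFInf_le`: perturbing ground
states at scale β^(-1/α), with α the Hölder exponent, costs O(log β) per particle uniformly in k, so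
βf_∞ ≤ βe_∞ + O(log β). The limits e_∞ and f_∞ exist by Fekete's lemma: energies are subadditive
since distant groups do not interact, and Z_k is supermultiplicative up to a constant since R > b
lets two clusters be joined without interacting (`orderedZ_mul_le`).

For ν > ν* off the kinks, one line (E_k - ν)/k realises μ(ν) < e_∞ and the others lie higher by at
least Δ. Since kρ_k ≤ ρ for this k, (ii) keeps the chemical potential below μ(ν) + ε, hence below
f_∞ by (i). The mass constraint is then saturated, and by (i) all sizes other than k carry an
exponentially small share of the mass (`isBigO_supersaturated`).

For ν < ν*, a ≤ 0 gives ρ_k ≤ exp(-β(k f_k - k f_∞)). For boundedly many k, (i) and (iii) bound the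
exponent by -βν* + O(log β); for larger k the surface hypothesis beats ν* and makes the sum converge
(`isBigO_gas`). -/

theorem PairPotential.ne_bot (hv : PairPotential d v rhc b) (r : ℝ≥0) : v r ≠ ⊥ := by
  rcases le_or_gt r rhc with h | h
  · simp [hv.hardcore r h]
  · exact (hv.finite r h).2

theorem PairPotential.ne_top_iff (hv : PairPotential d v rhc b) {r : ℝ≥0} :
    v r ≠ ⊤ ↔ rhc < r := by
  refine ⟨fun h => ?_, fun h => (hv.finite r h).1⟩
  by_contra h'
  exact h (hv.hardcore r (not_lt.1 h'))

theorem PairPotential.eq_zero_of_lt (hv : PairPotential d v rhc b) {r : ℝ≥0} (h : b < r) :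
    v r = 0 := by
  by_contra h'
  exact absurd (hv.range.1 h') (not_le.2 h)

/-- The energy of an unordered pair of particles. -/
noncomputable def pairEnergy (v : ℝ≥0 → EReal) {n : ℕ} (x : Fin n → Space d) :
    Sym2 (Fin n) → EReal :=
  Sym2.lift ⟨fun i j => v (nndist (x i) (x j)), fun _ _ => congrArg v (nndist_comm _ _)⟩

/-- Written over unordered pairs, the energy is visibly invariant under relabelling; the sum over i
< j is not. -/
theorem energy_eq_sum_sym2 {n : ℕ} (x : Fin n → Space d) :
    energy v x = ∑ e : Sym2 (Fin n) with ¬ e.IsDiag, pairEnergy v x e := by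
  have h := Finset.sum_sym2_filter_not_isDiag (Finset.univ : Finset (Fin n)) (pairEnergy v x)
  rw [Finset.sym2_univ] at h
  rw [h, energy, Finset.sum_sigma']
  refine Finset.sum_bij' (fun p _ => (p.1, p.2)) (fun p _ => ⟨p.1, p.2⟩) ?_ ?_ ?_ ?_ ?_
  · rintro ⟨i, j⟩ h; simp at h ⊢; exact ⟨h.ne, h⟩
  · rintro ⟨i, j⟩ h; simp at h ⊢; exact h.2
  · simp
  · simp
  · rintro ⟨i, j⟩ h; simp [pairEnergy]

theorem energy_comp_perm {n : ℕ} (x : Fin n → Space d) (σ : Equiv.Perm (Fin n)) :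
    energy v (x ∘ σ) = energy v x := by
  rw [energy_eq_sum_sym2, energy_eq_sum_sym2]
  refine Finset.sum_bij' (fun e _ => Sym2.map σ e) (fun e _ => Sym2.map σ.symm e) ?_ ?_ ?_ ?_ ?_
  · intro e he
    simpa [Sym2.isDiag_map σ.injective] using he
  · intro e he
    simpa [Sym2.isDiag_map σ.symm.injective] using he
  · intro e _
    simp [Sym2.map_map]
  · intro e _
    simp [Sym2.map_map]
  · intro e _
    induction e using Sym2.ind with | _ i j => simp [pairEnergy]

theorem energy_congr {n : ℕ} {x y : Fin n → Space d}
    (h : ∀ i j, i < j → v (nndist (x i) (x j)) = v (nndist (y i) (y j))) :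
    energy v x = energy v y :=
  Finset.sum_congr rfl fun i _ => Finset.sum_congr rfl fun j hj => h i j (Finset.mem_Ioi.1 hj)

theorem energy_add_const {n : ℕ} (x : Fin n → Space d) (a : Space d) :
    energy v (fun i => x i + a) = energy v x :=
  energy_congr fun i j _ => by rw [nndist_add_right]

theorem energy_eq_sum_ite {n : ℕ} (x : Fin n → Space d) :
    energy v x = ∑ i, ∑ j, if i < j then v (nndist (x i) (x j)) else 0 := by
  refine Finset.sum_congr rfl fun i _ => ?_
  rw [← Finset.sum_filter]
  congr 1
  ext j; simp

theorem energy_append (hv : PairPotential d v rhc b) {m n : ℕ} {x : Fin m → Space d}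
    {y : Fin n → Space d} (h : ∀ i j, b < nndist (x i) (y j)) :
    energy v (Fin.append x y) = energy v x + energy v y := by
  simp only [energy_eq_sum_ite, Fin.sum_univ_add, Fin.append_left, Fin.append_right]
  have h1 : ∀ i j, (if Fin.castAdd n i < Fin.natAdd m j then v (nndist (x i) (y j)) else 0) = 0 := by
    intro i j; rw [hv.eq_zero_of_lt (h i j), ite_self]
  have h2 : ∀ i j, ¬ (Fin.natAdd m j < Fin.castAdd n i) := by
    intro i j hij
    rw [Fin.lt_def] at hij
    simp at hij
    omega
  have h3 : ∀ i j : Fin m, Fin.castAdd n i < Fin.castAdd n j ↔ i < j := by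
    intro i j; rw [Fin.lt_def, Fin.lt_def]; simp
  have h4 : ∀ i j : Fin n, Fin.natAdd m i < Fin.natAdd m j ↔ i < j := by
    intro i j; rw [Fin.lt_def, Fin.lt_def]; simp
  simp only [h1, h2, h3, h4, if_false, Finset.sum_const_zero, add_zero, zero_add]

theorem sum_ne_bot {ι : Type*} (s : Finset ι) {f : ι → EReal} (h : ∀ i ∈ s, f i ≠ ⊥) :
    ∑ i ∈ s, f i ≠ ⊥ := by
  classical
  induction s using Finset.induction_on with
  | empty => simp
  | insert a s ha ih =>
    rw [Finset.sum_insert ha]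
    exact EReal.add_ne_bot_iff.2 ⟨h a (by simp), ih fun i hi => h i (by simp [hi])⟩

theorem ne_top_of_sum_ne_top {ι : Type*} {s : Finset ι} {f : ι → EReal} (h : ∀ i ∈ s, f i ≠ ⊥)
    (hs : ∑ i ∈ s, f i ≠ ⊤) {i : ι} (hi : i ∈ s) : f i ≠ ⊤ := by
  classical
  intro ht
  rw [← Finset.add_sum_erase s f hi, ht, EReal.top_add_of_ne_bot] at hs
  · exact hs rfl
  · exact sum_ne_bot _ fun j hj => h j (Finset.mem_of_mem_erase hj)

theorem energy_ne_bot (hv : PairPotential d v rhc b) {n : ℕ} (x : Fin n → Space d) :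
    energy v x ≠ ⊥ :=
  sum_ne_bot _ fun _ _ => sum_ne_bot _ fun _ _ => hv.ne_bot _

theorem lt_nndist_of_energy_ne_top (hv : PairPotential d v rhc b) {n : ℕ} {x : Fin n → Space d}
    (h : energy v x ≠ ⊤) {i j : Fin n} (hij : i ≠ j) : rhc < nndist (x i) (x j) := by
  wlog hlt : i < j generalizing i j
  · rw [nndist_comm]
    exact this hij.symm (lt_of_le_of_ne (not_lt.1 hlt) hij.symm)
  rw [← hv.ne_top_iff]
  exact ne_top_of_sum_ne_top (fun _ _ => hv.ne_bot _)
    (ne_top_of_sum_ne_top (fun _ _ => sum_ne_bot _ fun _ _ => hv.ne_bot _) h (Finset.mem_univ i))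
    (Finset.mem_Ioi.2 hlt)

/-- The energy as a real number, meaningful for configurations of finite energy. -/
noncomputable def realEnergy (v : ℝ≥0 → EReal) {n : ℕ} (x : Fin n → Space d) : ℝ :=
  ∑ i, ∑ j ∈ Finset.Ioi i, (v (nndist (x i) (x j))).toReal

theorem energy_eq_coe_realEnergy (hv : PairPotential d v rhc b) {n : ℕ} {x : Fin n → Space d}
    (h : ∀ i j, i ≠ j → rhc < nndist (x i) (x j)) : energy v x = (realEnergy v x : EReal) := by
  have hs : ∀ (s : Finset (Fin n)) (f : Fin n → ℝ),
      ((∑ i ∈ s, f i : ℝ) : EReal) = ∑ i ∈ s, (f i : EReal) := by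
    intro s f
    exact map_sum (⟨⟨Real.toEReal, rfl⟩, EReal.coe_add⟩ : ℝ →+ EReal) f s
  rw [energy, realEnergy, hs]
  refine Finset.sum_congr rfl fun i _ => ?_
  rw [hs]
  refine Finset.sum_congr rfl fun j hj => ?_
  have := hv.finite _ (h i j (Finset.mem_Ioi.1 hj).ne)
  rw [EReal.coe_toReal this.1 this.2]

theorem nearGraph_adj {R : ℝ} {n : ℕ} {x : Fin n → Space d} {i j : Fin n} :
    (SimpleGraph.fromRel fun i j => dist (x i) (x j) ≤ R).Adj i j ↔
      i ≠ j ∧ dist (x i) (x j) ≤ R := by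
  rw [SimpleGraph.fromRel_adj, dist_comm (x j), or_self]

theorem IsCluster.mono {R S : ℝ} {n : ℕ} {x y : Fin n → Space d} (hx : IsCluster R x)
    (h : ∀ i j, dist (x i) (x j) ≤ R → dist (y i) (y j) ≤ S) : IsCluster S y := by
  refine SimpleGraph.Connected.mono (fun i j hij => ?_) hx
  rw [nearGraph_adj] at hij ⊢
  exact ⟨hij.1, h i j hij.2⟩

theorem abs_apply_sub_le_dist (o : Fin d) (x y : Space d) : |x o - y o| ≤ dist x y := by
  rw [dist_eq_norm, ← Real.norm_eq_abs]
  exact PiLp.norm_apply_le (x - y) o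

open Classical in
/-- Components of a configuration that are too far apart to interact can be pushed together
without changing the energy. -/
theorem exists_isCluster_energy_eq (hv : PairPotential d v rhc b) (o : Fin d) {R : ℝ}
    (hR : (b : ℝ) < R) {n : ℕ} [NeZero n] (x : Fin n → Space d) :
    ∃ y : Fin n → Space d, IsCluster R y ∧ energy v y = energy v x := by
  let f : (Fin n → Space d) → Finset (Fin n × Fin n) := fun x =>
    Finset.univ.filter fun p => dist (x p.1) (x p.2) ≤ R
  -- Strong induction on the number of ordered pairs farther apart than R.
  have key : ∀ (N : ℕ) (x : Fin n → Space d),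
      (Finset.univ : Finset (Fin n × Fin n)).card - (f x).card = N →
      ∃ y : Fin n → Space d, IsCluster R y ∧ energy v y = energy v x := by
    intro N
    induction N using Nat.strong_induction_on with | _ N ih => ?_
    intro x hN
    by_cases hx : IsCluster R x
    · exact ⟨x, hx, rfl⟩
    set G := SimpleGraph.fromRel fun i j => dist (x i) (x j) ≤ R with hG
    have hpre : ¬ G.Preconnected := fun h => hx ⟨h⟩
    obtain ⟨i₀, j₀, hij₀⟩ : ∃ i j, ¬ G.Reachable i j := by
      simpa [SimpleGraph.Preconnected] using hpre
    let C : Finset (Fin n) := Finset.univ.filter fun i => G.Reachable i₀ i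
    have hfar : ∀ i ∈ C, ∀ j ∉ C, R < dist (x i) (x j) := by
      intro i hi j hj
      by_contra hle
      have hi' : G.Reachable i₀ i := by simpa [C] using hi
      have hj' : ¬ G.Reachable i₀ j := by simpa [C] using hj
      refine hj' (hi'.trans (SimpleGraph.Adj.reachable ?_))
      rw [hG, nearGraph_adj]
      exact ⟨by rintro rfl; exact hj hi, not_lt.1 hle⟩
    obtain ⟨l, hl, hlmin⟩ := Finset.exists_min_image C (fun i => x i o)
      ⟨i₀, by simp [C]⟩
    obtain ⟨r, hr, hrmax⟩ := Finset.exists_max_image Cᶜ (fun i => x i o)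
      ⟨j₀, by simpa [C] using hij₀⟩
    -- This shift puts the leftmost particle l of the component C at distance exactly R, in
    -- direction o, from the rightmost particle r outside C. All cross distances are then at least R
    -- > b, so no interaction appears, while the pair (l, r) becomes adjacent.
    let a : Space d := x r - x l + EuclideanSpace.single o R
    let y : Fin n → Space d := fun i => if i ∈ C then x i + a else x i
    have hyC : ∀ i ∈ C, y i = x i + a := fun i hi => if_pos hi
    have hyN : ∀ i ∉ C, y i = x i := fun i hi => if_neg hi
    have hcross : ∀ i ∈ C, ∀ j ∉ C, R ≤ dist (y i) (y j) := by
      intro i hi j hj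
      refine le_trans ?_ (abs_apply_sub_le_dist o _ _)
      rw [hyC i hi, hyN j hj]
      have h1 := hlmin i hi
      have h2 := hrmax j (by simpa using hj)
      simp only [a, PiLp.add_apply, PiLp.sub_apply, PiLp.single_apply, if_true]
      refine le_trans ?_ (le_abs_self _)
      linarith
    have hb : ∀ i j, R ≤ dist (x i) (x j) → v (nndist (x i) (x j)) = 0 := by
      intro i j h
      refine hv.eq_zero_of_lt ?_
      rw [← NNReal.coe_lt_coe, coe_nndist]; linarith
    have hb' : ∀ i j, R ≤ dist (y i) (y j) → v (nndist (y i) (y j)) = 0 := by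
      intro i j h
      refine hv.eq_zero_of_lt ?_
      rw [← NNReal.coe_lt_coe, coe_nndist]; linarith
    have hyE : energy v y = energy v x := by
      refine energy_congr fun i j _ => ?_
      by_cases hi : i ∈ C <;> by_cases hj : j ∈ C
      · rw [hyC i hi, hyC j hj, nndist_add_right]
      · rw [hb i j (hfar i hi j hj).le, hb' i j (hcross i hi j hj)]
      · rw [nndist_comm (y i), nndist_comm (x i), hb j i (hfar j hj i hi).le,
          hb' j i (hcross j hj i hi)]
      · rw [hyN i hi, hyN j hj]
    have hR0 : 0 ≤ R := b.coe_nonneg.trans hR.le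
    have hsub : f x ⊂ f y := by
      rw [Finset.ssubset_iff_of_subset]
      · refine ⟨(l, r), ?_, ?_⟩
        · have hr' : r ∉ C := by simpa using hr
          simp only [f, Finset.mem_filter, Finset.mem_univ, true_and]
          rw [hyC l hl, hyN r hr', dist_eq_norm]
          have : x l + a - x r = EuclideanSpace.single o R := by simp only [a]; abel
          rw [this]
          simp [abs_of_nonneg hR0]
        · simp only [f, Finset.mem_filter, Finset.mem_univ, true_and, not_le]
          exact hfar l hl r (by simpa using hr)
      · rintro ⟨i, j⟩ hij
        simp only [f, Finset.mem_filter, Finset.mem_univ, true_and] at hij ⊢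
        by_cases hi : i ∈ C <;> by_cases hj : j ∈ C
        · rwa [hyC i hi, hyC j hj, dist_add_right]
        · exact absurd hij (not_le.2 (hfar i hi j hj))
        · rw [dist_comm] at hij
          exact absurd hij (not_le.2 (hfar j hj i hi))
        · rwa [hyN i hi, hyN j hj]
    have hcard := Finset.card_lt_card hsub
    have hle := Finset.card_le_card (Finset.subset_univ (f y))
    obtain ⟨z, hz, hzE⟩ := ih _ (by omega) y rfl
    exact ⟨z, hz, hzE.trans hyE⟩
  exact key _ x rfl

/-- Particles spaced b + 1 apart on a line do not interact. This keeps the infimum of the energy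
below `⊤`, so that `toReal` in `groundE` loses nothing. -/
theorem exists_energy_eq_zero (hv : PairPotential d v rhc b) (o : Fin d) (n : ℕ) :
    ∃ x : Fin n → Space d, energy v x = 0 := by
  refine ⟨fun i => EuclideanSpace.single o (((b : ℝ) + 1) * (i : ℕ)), ?_⟩
  refine Finset.sum_eq_zero fun i _ => Finset.sum_eq_zero fun j hj => hv.eq_zero_of_lt ?_
  rw [← NNReal.coe_lt_coe, coe_nndist, dist_comm]
  refine lt_of_lt_of_le ?_ ((le_abs_self _).trans (abs_apply_sub_le_dist o _ _))
  have hij : (i : ℕ) + 1 ≤ j := Finset.mem_Ioi.1 hj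
  have hij' : ((i : ℕ) : ℝ) + 1 ≤ (j : ℕ) := by exact_mod_cast hij
  simp only [PiLp.single_apply, if_true]
  nlinarith [b.coe_nonneg]

theorem coe_groundE (hv : PairPotential d v rhc b) (o : Fin d) (k : ℕ+) :
    (groundE d v k : EReal) = ⨅ x : Fin k → Space d, energy v x := by
  refine EReal.coe_toReal ?_ ?_
  · obtain ⟨x, hx⟩ := exists_energy_eq_zero hv o (k : ℕ)
    intro h
    have := iInf_le (fun x : Fin k → Space d => energy v x) x
    rw [h, hx] at this
    simp at this
  · obtain ⟨B, hB⟩ := hv.stable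
    intro h
    have : ((-(B * (k : ℕ)) : ℝ) : EReal) ≤ ⨅ x : Fin k → Space d, energy v x :=
      le_iInf fun x => hB k x
    rw [h, le_bot_iff] at this
    exact EReal.coe_ne_bot _ this

theorem groundE_le (hv : PairPotential d v rhc b) (o : Fin d) (k : ℕ+) (x : Fin k → Space d) :
    (groundE d v k : EReal) ≤ energy v x := by
  rw [coe_groundE hv o]; exact iInf_le _ x

theorem exists_energy_lt (hv : PairPotential d v rhc b) (o : Fin d) (k : ℕ+) {c : ℝ}
    (hc : groundE d v k < c) : ∃ x : Fin k → Space d, energy v x < c := by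
  have : (groundE d v k : EReal) < c := by exact_mod_cast hc
  rw [coe_groundE hv o] at this
  exact iInf_lt_iff.1 this

theorem exists_le_groundE (hv : PairPotential d v rhc b) (o : Fin d) :
    ∃ B : ℝ, ∀ k : ℕ+, -(B * k) ≤ groundE d v k := by
  obtain ⟨B, hB⟩ := hv.stable
  refine ⟨B, fun k => ?_⟩
  have : ((-(B * (k : ℕ)) : ℝ) : EReal) ≤ groundE d v k := by
    rw [coe_groundE hv o]; exact le_iInf fun x => hB k x
  exact_mod_cast this

/-- Near-minimisers of m and n particles, translated more than b apart, do not interact. Only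
near-minimisers are available, as ground states need not exist here. -/
theorem groundE_add_le (hv : PairPotential d v rhc b) (o : Fin d) (m n : ℕ+) :
    groundE d v (m + n) ≤ groundE d v m + groundE d v n := by
  refine le_of_forall_pos_le_add fun ε hε => ?_
  obtain ⟨x, hx⟩ := exists_energy_lt hv o m (c := groundE d v m + ε / 2) (by linarith)
  obtain ⟨y, hy⟩ := exists_energy_lt hv o n (c := groundE d v n + ε / 2) (by linarith)
  let T : ℝ := b + 1 + ∑ i, |x i o| + ∑ j, |y j o|
  have hfar : ∀ i j, b < nndist (x i) (y j + EuclideanSpace.single o T) := by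
    intro i j
    rw [← NNReal.coe_lt_coe, coe_nndist, dist_comm]
    refine lt_of_lt_of_le ?_ ((le_abs_self _).trans (abs_apply_sub_le_dist o _ _))
    have h1 := Finset.single_le_sum (f := fun i => |x i o|) (fun _ _ => abs_nonneg _)
      (Finset.mem_univ i)
    have h2 := Finset.single_le_sum (f := fun i => |y i o|) (fun _ _ => abs_nonneg _)
      (Finset.mem_univ j)
    simp only [PiLp.add_apply, PiLp.single_apply, if_true, T]
    have := le_abs_self (x i o)
    have := neg_abs_le (y j o)
    simp only at h1 h2
    linarith
  have h := energy_append hv hfar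
  rw [energy_add_const] at h
  have hle := groundE_le hv o (m + n) (Fin.append x fun j => y j + EuclideanSpace.single o T)
  have : (groundE d v (m + n) : EReal) ≤
      ((groundE d v m + ε / 2 : ℝ) : EReal) + ((groundE d v n + ε / 2 : ℝ) : EReal) :=
    hle.trans (h.le.trans (add_le_add hx.le hy.le))
  have h3 : groundE d v (m + n) ≤ (groundE d v m + ε / 2) + (groundE d v n + ε / 2) := by
    exact_mod_cast this
  linarith

/-- Fekete's lemma for sequences indexed by the positive integers. -/
theorem tendsto_div_of_subadditive {u : ℕ+ → ℝ} (h : ∀ m n, u (m + n) ≤ u m + u n) {B : ℝ}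
    (hB : ∀ k : ℕ+, -(B * k) ≤ u k) :
    ∃ l : ℝ, Tendsto (fun k : ℕ+ => u k / k) atTop (𝓝 l) ∧ ∀ k : ℕ+, l * k ≤ u k := by
  let w : ℕ → ℝ := fun n => if hn : 0 < n then u ⟨n, hn⟩ else 0
  have hw : ∀ k : ℕ+, w k = u k := fun k => dif_pos k.pos
  have hw0 : w 0 = 0 := by simp [w]
  have hsub : Subadditive w := by
    intro m n
    rcases Nat.eq_zero_or_pos m with rfl | hm
    · simp [hw0]
    rcases Nat.eq_zero_or_pos n with rfl | hn
    · simp [hw0]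
    exact (hw (⟨m, hm⟩ + ⟨n, hn⟩)).le.trans
      ((h _ _).trans (add_le_add (hw ⟨m, hm⟩).ge (hw ⟨n, hn⟩).ge))
  have hbdd : BddBelow (Set.range fun n : ℕ => w n / n) := by
    -- The 0 accounts for the index n = 0, where the quotient is 0/0 = 0.
    refine ⟨min 0 (-B), ?_⟩
    rintro _ ⟨n, rfl⟩
    rcases Nat.eq_zero_or_pos n with rfl | hn
    · simp
    · refine (min_le_right _ _).trans ?_
      have h1 := hB ⟨n, hn⟩
      rw [← hw ⟨n, hn⟩] at h1
      have : (0 : ℝ) < n := by exact_mod_cast hn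
      simp only [le_div_iff₀ this]
      simp only [PNat.mk_coe] at h1
      linarith
  refine ⟨hsub.lim, ?_, fun k => ?_⟩
  · have h1 := (hsub.tendsto_lim hbdd).comp tendsto_PNat_val_atTop_atTop
    refine h1.congr fun k => ?_
    simp [hw]
  · have h1 := hsub.lim_le_div hbdd k.ne_zero
    rw [hw, le_div_iff₀ (by exact_mod_cast k.pos)] at h1
    exact h1

theorem tendsto_groundE_div (hv : PairPotential d v rhc b) (o : Fin d) :
    Tendsto (fun k : ℕ+ => groundE d v k / k) atTop (𝓝 (groundEInf d v)) ∧
      ∀ k : ℕ+, groundEInf d v * k ≤ groundE d v k := by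
  obtain ⟨B, hB⟩ := exists_le_groundE hv o
  obtain ⟨l, hl, hle⟩ := tendsto_div_of_subadditive (groundE_add_le hv o) hB
  have : groundEInf d v = l := hl.limUnder_eq
  rw [this]
  exact ⟨hl, hle⟩

end IdealMixture

/-! ### Translation-invariant integrals, pinning and relabelling -/

namespace IdealMixture

variable {d : ℕ} {v : ℝ≥0 → EReal} {rhc b : ℝ≥0}

section TranslationInvariant

variable {n : ℕ} {ψ : Space d → ℝ≥0∞} {G : (Fin n → Space d) → ℝ≥0∞}

/-- A translation invariant function can be integrated by pinning its first argument. -/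
theorem lintegral_apply_zero_mul {ψ : Space d → ℝ≥0∞} (hψ : Measurable ψ)
    {G : (Fin (n + 1) → Space d) → ℝ≥0∞} (hG : Measurable G)
    (hinv : ∀ x a, G (fun i => x i + a) = G x) :
    ∫⁻ x, ψ (x 0) * G x = (∫⁻ a, ψ a) * ∫⁻ y : Fin n → Space d, G (Fin.cons 0 y) := by
  have hmp := (volume_preserving_piFinSuccAbove (fun _ : Fin (n + 1) => Space d) 0).symm
  have hm : Measurable fun x : Fin (n + 1) → Space d => ψ (x 0) * G x := by fun_prop
  have hm' := hm.comp hmp.measurable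
  simp only [Function.comp_def] at hm'
  rw [← hmp.lintegral_comp hm, Measure.volume_eq_prod, lintegral_prod _ hm'.aemeasurable]
  have hcons : ∀ (a : Space d) (y : Fin n → Space d),
      (MeasurableEquiv.piFinSuccAbove (fun _ : Fin (n + 1) => Space d) 0).symm (a, y)
        = Fin.cons a y := fun a y => by
    simp [MeasurableEquiv.piFinSuccAbove, Fin.insertNthEquiv]
  simp only [hcons, Fin.cons_zero]
  have hmc : Measurable fun y : Fin n → Space d => G (Fin.cons 0 y) := by
    refine hG.comp (measurable_pi_iff.2 fun i => ?_)
    refine Fin.cases ?_ (fun j => ?_) i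
    · simp
    · simpa using measurable_pi_apply j
  rw [← lintegral_mul_const _ hψ]
  refine lintegral_congr fun a => ?_
  have hma : Measurable fun y : Fin n → Space d => G (Fin.cons a y) := by
    refine hG.comp (measurable_pi_iff.2 fun i => ?_)
    refine Fin.cases ?_ (fun j => ?_) i
    · simp
    · simpa using measurable_pi_apply j
  rw [lintegral_const_mul _ hma]
  congr 1
  -- Shifting the free particles by a turns the configuration pinned at a into a translate of the
  -- one pinned at 0.
  rw [← lintegral_add_right_eq_self _ (fun _ : Fin n => a)]
  refine lintegral_congr fun y => ?_
  rw [← hinv (Fin.cons 0 y) a]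
  congr 1
  ext i : 1
  refine Fin.cases ?_ (fun j => ?_) i
  · simp
  · simp

/-- The pin ψ may sit on any particle: insert 1 = ∫ ψ(x_j + t) dt, translate the configuration by
-t, and integrate t out of ψ(x_i - t). -/
theorem lintegral_apply_mul_eq (hψ : Measurable ψ) (h1 : ∫⁻ a, ψ a = 1) (hG : Measurable G)
    (hinv : ∀ x a, G (fun i => x i + a) = G x) (i j : Fin n) :
    ∫⁻ x, ψ (x i) * G x = ∫⁻ x, ψ (x j) * G x := by
  calc ∫⁻ x, ψ (x i) * G x
      = ∫⁻ x : Fin n → Space d, ∫⁻ t, ψ (x i) * G x * ψ (x j + t) := by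
        refine lintegral_congr fun x => ?_
        rw [lintegral_const_mul _ (by fun_prop), lintegral_add_left_eq_self ψ (x j), h1, mul_one]
    _ = ∫⁻ t, ∫⁻ x : Fin n → Space d, ψ (x i) * G x * ψ (x j + t) := by
        rw [lintegral_lintegral_swap]
        apply Measurable.aemeasurable
        simp only [Function.uncurry_def]
        fun_prop
    _ = ∫⁻ t, ∫⁻ x : Fin n → Space d, ψ (x i + -t) * G x * ψ (x j) := by
        refine lintegral_congr fun t => ?_
        rw [← lintegral_add_right_eq_self _ (fun _ : Fin n => -t)]
        refine lintegral_congr fun x => ?_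
        have := hinv x (-t)
        simp only [Pi.add_apply, neg_add_cancel_right]
        rw [show (x + fun _ => -t) = fun i => x i + -t from rfl, this]
    _ = ∫⁻ x : Fin n → Space d, ∫⁻ t, ψ (x i + -t) * G x * ψ (x j) := by
        rw [lintegral_lintegral_swap]
        apply Measurable.aemeasurable
        simp only [Function.uncurry_def]
        fun_prop
    _ = ∫⁻ x, ψ (x j) * G x := by
        refine lintegral_congr fun x => ?_
        have hm : Measurable fun t => ψ (x i + -t) := by fun_prop
        simp only [mul_assoc]
        rw [lintegral_mul_const _ hm]
        simp only [← sub_eq_add_neg]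
        rw [lintegral_sub_left_eq_self ψ (x i), h1, one_mul, mul_comm]

/-- Relabelling moves the pin to another particle; `lintegral_apply_mul_eq` moves it back. -/
theorem lintegral_apply_mul_comp_perm (hψ : Measurable ψ) (h1 : ∫⁻ a, ψ a = 1)
    (hG : Measurable G) (hinv : ∀ x a, G (fun i => x i + a) = G x) (i : Fin n)
    (σ : Equiv.Perm (Fin n)) :
    ∫⁻ x, ψ (x i) * G (x ∘ σ) = ∫⁻ x, ψ (x i) * G x := by
  have hmp := volume_measurePreserving_piCongrLeft (fun _ : Fin n => Space d) σ.symm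
  have hval : ∀ x : Fin n → Space d,
      MeasurableEquiv.piCongrLeft (fun _ : Fin n => Space d) σ.symm x = x ∘ σ := by
    intro x
    ext j : 1
    have := MeasurableEquiv.piCongrLeft_apply_apply (β := fun _ : Fin n => Space d) σ.symm x (σ j)
    simpa using this
  have hm : Measurable fun x : Fin n → Space d => ψ (x (σ.symm i)) * G x := by fun_prop
  rw [lintegral_apply_mul_eq hψ h1 hG hinv i (σ.symm i), ← hmp.lintegral_comp hm]
  refine lintegral_congr fun x => ?_
  rw [hval]
  simp

theorem measurable_comp_perm (σ : Equiv.Perm (Fin n)) :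
    Measurable fun x : Fin n → Space d => x ∘ σ :=
  measurable_pi_iff.2 fun j => measurable_pi_apply (σ j)

open Classical in
/-- Summing a translation invariant indicator over all relabellings. -/
theorem lintegral_apply_mul_sum_perm (hψ : Measurable ψ) (h1 : ∫⁻ a, ψ a = 1)
    (hG : Measurable G) (hinv : ∀ x a, G (fun i => x i + a) = G x) (i : Fin n) :
    ∫⁻ x, ψ (x i) * ∑ σ : Equiv.Perm (Fin n), G (x ∘ σ) = (n ! : ℝ≥0∞) * ∫⁻ x, ψ (x i) * G x := by
  simp only [Finset.mul_sum]
  rw [lintegral_finsetSum]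
  · simp only [lintegral_apply_mul_comp_perm hψ h1 hG hinv, Finset.sum_const, Finset.card_univ,
      Fintype.card_perm, Fintype.card_fin, nsmul_eq_mul]
  · intro σ _
    exact (hψ.comp (measurable_pi_apply i)).mul (hG.comp (measurable_comp_perm σ))

/-- If the relabellings of `A` are disjoint, a symmetric integral is at least `n!` times the
integral over `A`. -/
theorem factorial_mul_lintegral_indicator_le (hψ : Measurable ψ) (h1 : ∫⁻ a, ψ a = 1)
    (hG : Measurable G) (hinv : ∀ x a, G (fun i => x i + a) = G x)
    (hsymm : ∀ x (σ : Equiv.Perm (Fin n)), G (x ∘ σ) = G x) {A : Set (Fin n → Space d)}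
    (hA : MeasurableSet A) (hAinv : ∀ x a, (fun i => x i + a) ∈ A ↔ x ∈ A)
    (hdisj : ∀ (x : Fin n → Space d) (σ τ : Equiv.Perm (Fin n)), x ∘ σ ∈ A → x ∘ τ ∈ A → σ = τ)
    (i : Fin n) :
    (n ! : ℝ≥0∞) * ∫⁻ x, ψ (x i) * A.indicator G x ≤ ∫⁻ x, ψ (x i) * G x := by
  classical
  rw [← lintegral_apply_mul_sum_perm hψ h1 (hG.indicator hA)
    (fun x a => by simp only [Set.indicator, hAinv, hinv])]
  refine lintegral_mono fun x => mul_le_mul_right ?_ _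
  by_cases h : ∃ σ : Equiv.Perm (Fin n), x ∘ σ ∈ A
  · obtain ⟨σ, hσ⟩ := h
    rw [Finset.sum_eq_single σ]
    · rw [Set.indicator_of_mem hσ, hsymm]
    · intro τ _ hτ
      exact Set.indicator_of_notMem (fun h => hτ (hdisj x τ σ h hσ)) _
    · simp
  · push Not at h
    simp [Set.indicator_of_notMem (h _)]

/-- If almost every configuration has a relabelling in `A`, a symmetric integral is at most `n!`
times the integral over `A`. -/
theorem lintegral_le_factorial_mul_indicator (hψ : Measurable ψ) (h1 : ∫⁻ a, ψ a = 1)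
    (hG : Measurable G) (hinv : ∀ x a, G (fun i => x i + a) = G x)
    (hsymm : ∀ x (σ : Equiv.Perm (Fin n)), G (x ∘ σ) = G x) {A : Set (Fin n → Space d)}
    (hA : MeasurableSet A) (hAinv : ∀ x a, (fun i => x i + a) ∈ A ↔ x ∈ A)
    (hex : ∀ᵐ x : Fin n → Space d, ∃ σ : Equiv.Perm (Fin n), x ∘ σ ∈ A) (i : Fin n) :
    ∫⁻ x, ψ (x i) * G x ≤ (n ! : ℝ≥0∞) * ∫⁻ x, ψ (x i) * A.indicator G x := by
  classical
  rw [← lintegral_apply_mul_sum_perm hψ h1 (hG.indicator hA)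
    (fun x a => by simp only [Set.indicator, hAinv, hinv])]
  refine lintegral_mono_ae ?_
  filter_upwards [hex] with x hx
  refine mul_le_mul_right ?_ _
  obtain ⟨σ, hσ⟩ := hx
  refine le_trans (le_of_eq ?_) (Finset.single_le_sum (fun _ _ => zero_le) (Finset.mem_univ σ))
  rw [Set.indicator_of_mem hσ, hsymm]

end TranslationInvariant

/-- The normalised indicator of the unit ball. -/
noncomputable def bump (d : ℕ) : Space d → ℝ≥0∞ :=
  (Metric.ball (0 : Space d) 1).indicator fun _ => (volume (Metric.ball (0 : Space d) 1))⁻¹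

theorem measurable_bump : Measurable (bump d) :=
  measurable_const.indicator measurableSet_ball

theorem lintegral_bump : ∫⁻ a, bump d a = 1 := by
  rw [bump, lintegral_indicator measurableSet_ball, setLIntegral_const, ENNReal.inv_mul_cancel]
  · exact (Metric.measure_ball_pos volume _ one_pos).ne'
  · exact measure_ball_lt_top.ne

/-- The configurations whose particles are labelled by increasing coordinate `o`. -/
def ordered (o : Fin d) (n : ℕ) : Set (Fin n → Space d) :=
  {x | StrictMono fun i => x i o}

theorem measurableSet_ordered (o : Fin d) (n : ℕ) : MeasurableSet (ordered o n) := by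
  have : ordered o n = ⋂ i, ⋂ j, ⋂ _ : i < j, {x : Fin n → Space d | x i o < x j o} := by
    ext x; simp [ordered, StrictMono]
  rw [this]
  refine MeasurableSet.iInter fun i => MeasurableSet.iInter fun j => MeasurableSet.iInter fun _ => ?_
  exact measurableSet_lt (by fun_prop) (by fun_prop)

/-- Each coincidence x_i o = x_j o is the kernel of a nonzero linear functional, hence a null set.
-/
theorem ae_injective_coord (o : Fin d) (n : ℕ) :
    ∀ᵐ x : Fin n → Space d, Function.Injective fun i => x i o := by
  have h : ∀ i j : Fin n, i ≠ j → ∀ᵐ x : Fin n → Space d, x i o ≠ x j o := by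
    intro i j hij
    let f : (Fin n → Space d) →ₗ[ℝ] ℝ :=
      (EuclideanSpace.proj o : Space d →L[ℝ] ℝ).toLinearMap ∘ₗ
        ((LinearMap.proj i : (Fin n → Space d) →ₗ[ℝ] Space d) - LinearMap.proj j)
    have hf : ∀ x, f x = x i o - x j o := fun x => by simp [f]
    have hne : LinearMap.ker f ≠ ⊤ := by
      intro htop
      have : f (Pi.single i (EuclideanSpace.single o 1)) = 0 := by
        rw [← LinearMap.mem_ker, htop]; trivial
      rw [hf] at this
      simp [Pi.single_eq_of_ne hij.symm] at this
    have := Measure.addHaar_submodule (volume : Measure (Fin n → Space d)) (LinearMap.ker f) hne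
    refine measure_mono_null (fun x hx => ?_) this
    simp only [Set.mem_compl_iff, Set.mem_ofPred_eq, not_not] at hx
    simp [LinearMap.mem_ker, hf, hx]
  have h' : ∀ᵐ x : Fin n → Space d, ∀ i j : Fin n, i ≠ j → x i o ≠ x j o := by
    refine ae_all_iff.2 fun i => ae_all_iff.2 fun j => ?_
    by_cases hij : i = j
    · simp [hij]
    · filter_upwards [h i j hij] with x hx _ using hx
  filter_upwards [h'] with x hx i j hij
  by_contra hne
  exact hx i j hne hij

theorem exists_perm_mem_ordered {o : Fin d} {n : ℕ} {x : Fin n → Space d}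
    (hx : Function.Injective fun i => x i o) : ∃ σ : Equiv.Perm (Fin n), x ∘ σ ∈ ordered o n := by
  refine ⟨Tuple.sort fun i => x i o, ?_⟩
  exact (Tuple.monotone_sort fun i => x i o).strictMono_of_injective
    (hx.comp (Equiv.injective _))

theorem perm_eq_of_mem_ordered {o : Fin d} {n : ℕ} {x : Fin n → Space d}
    {σ τ : Equiv.Perm (Fin n)} (hσ : x ∘ σ ∈ ordered o n) (hτ : x ∘ τ ∈ ordered o n) : σ = τ := by
  have hσ' : StrictMono ((fun i => x i o) ∘ σ) := hσ
  have hτ' : StrictMono ((fun i => x i o) ∘ τ) := hτ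
  have hinj : Function.Injective fun i => x i o := by
    have := hσ'.injective.comp σ.symm.injective
    simpa [Function.comp_assoc] using this
  have := Tuple.unique_monotone hσ'.monotone hτ'.monotone
  ext i : 1
  exact hinj (congrFun this i)

end IdealMixture

/-! ### The cluster partition function and its supermultiplicativity -/

namespace IdealMixture

variable {d : ℕ} {v : ℝ≥0 → EReal} {rhc b : ℝ≥0} {R β : ℝ}

theorem PairPotential.measurable (hv : PairPotential d v rhc b) : Measurable v := by
  classical
  let S : Set ℝ≥0 := {r | rhc ≤ r ∧ 0 < r}
  have hS : MeasurableSet S := measurableSet_Ici.inter measurableSet_Ioi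
  have h := ContinuousOn.measurable_piecewise (s := S) (f := v) (g := fun _ => (⊤ : EReal))
    hv.continuousOn continuousOn_const hS
  convert h using 1
  ext r
  by_cases hr : r ∈ S
  · rw [Set.piecewise_eq_of_mem _ _ _ hr]
  · rw [Set.piecewise_eq_of_notMem _ _ _ hr]
    refine hv.hardcore r ?_
    simp only [S, Set.mem_ofPred_eq, not_and_or, not_le, not_lt] at hr
    rcases hr with hr | hr
    · exact hr.le
    · exact hr.trans zero_le

theorem measurable_energy (hv : PairPotential d v rhc b) (n : ℕ) :
    Measurable fun x : Fin n → Space d => energy v x := by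
  refine Finset.measurable_fun_sum _ fun i _ => Finset.measurable_fun_sum _ fun j _ => ?_
  exact hv.measurable.comp (by fun_prop)

theorem measurableSet_isCluster (R : ℝ) (n : ℕ) :
    MeasurableSet {x : Fin n → Space d | IsCluster R x} := by
  -- Connectedness depends only on this finite table of truth values, so it is the preimage of a set
  -- in a discrete space.
  let f : (Fin n → Space d) → (Fin n → Fin n → Prop) := fun x i j => dist (x i) (x j) ≤ R
  have hf : Measurable f := by
    refine measurable_pi_iff.2 fun i => measurable_pi_iff.2 fun j => ?_
    exact measurableSet_setOfPred.1 (measurableSet_le (by fun_prop) measurable_const)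
  exact hf (MeasurableSet.of_discrete (s := {r | (SimpleGraph.fromRel r).Connected}))

theorem measurable_clusterWeight (hv : PairPotential d v rhc b) (R β : ℝ) (n : ℕ) :
    Measurable fun x : Fin n → Space d => clusterWeight v R β x := by
  have h : Measurable fun x : Fin n → Space d => EReal.exp (-((β : EReal) * energy v x)) :=
    EReal.measurable_exp.comp (((measurable_energy hv n).const_mul _).neg)
  exact h.indicator (measurableSet_isCluster R n)

theorem clusterWeight_of_isCluster {n : ℕ} {x : Fin n → Space d} (h : IsCluster R x) :
    clusterWeight v R β x = EReal.exp (-((β : EReal) * energy v x)) :=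
  Set.indicator_of_mem (s := {x | IsCluster R x}) h _

theorem clusterWeight_of_not_isCluster {n : ℕ} {x : Fin n → Space d} (h : ¬ IsCluster R x) :
    clusterWeight v R β x = 0 :=
  Set.indicator_of_notMem (s := {x | IsCluster R x}) h _

theorem isCluster_add_const {n : ℕ} (x : Fin n → Space d) (a : Space d) :
    IsCluster R (fun i => x i + a) ↔ IsCluster R x := by
  simp only [IsCluster, dist_add_right]

theorem clusterWeight_add_const {n : ℕ} (x : Fin n → Space d) (a : Space d) :
    clusterWeight v R β (fun i => x i + a) = clusterWeight v R β x := by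
  classical
  simp only [clusterWeight, Set.indicator_apply, Set.mem_ofPred_eq, isCluster_add_const,
    energy_add_const]

theorem isCluster_comp_perm {n : ℕ} (x : Fin n → Space d) (σ : Equiv.Perm (Fin n)) :
    IsCluster R (x ∘ σ) ↔ IsCluster R x := by
  refine SimpleGraph.Iso.connected_iff (⟨σ, ?_⟩ : (SimpleGraph.fromRel fun i j =>
    dist ((x ∘ σ) i) ((x ∘ σ) j) ≤ R) ≃g SimpleGraph.fromRel fun i j => dist (x i) (x j) ≤ R)
  intro i j
  rw [nearGraph_adj, nearGraph_adj]
  simp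

theorem clusterWeight_comp_perm {n : ℕ} (x : Fin n → Space d) (σ : Equiv.Perm (Fin n)) :
    clusterWeight v R β (x ∘ σ) = clusterWeight v R β x := by
  classical
  simp only [clusterWeight, Set.indicator_apply, Set.mem_ofPred_eq, isCluster_comp_perm,
    energy_comp_perm]

/-- Replacing the particle fixed at the origin by a weight of mass one puts all k particles on the
same footing, so that permutations can act. -/
theorem clusterZ_eq_lintegral (hv : PairPotential d v rhc b) (k : ℕ+) :
    clusterZ d v R β k = ((k : ℕ)! : ℝ≥0∞)⁻¹ *
      ∫⁻ x : Fin k → Space d, bump d (x 0) * clusterWeight v R β x := by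
  obtain ⟨n, rfl⟩ : ∃ n : ℕ, k = n.succPNat := ⟨k.natPred, (PNat.succPNat_natPred k).symm⟩
  have h := lintegral_apply_zero_mul (measurable_bump (d := d))
    (measurable_clusterWeight hv R β (n + 1)) clusterWeight_add_const
  rw [lintegral_bump, one_mul] at h
  rw [clusterZ]
  congr 1
  exact h.symm

/-- The part of the cluster integral over configurations labelled by increasing coordinate. -/
noncomputable def orderedZ (v : ℝ≥0 → EReal) (R β : ℝ) (o : Fin d) (n : ℕ) [NeZero n] : ℝ≥0∞ :=
  ∫⁻ x : Fin n → Space d, bump d (x 0) * (ordered o n).indicator (clusterWeight v R β) x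

theorem add_const_mem_ordered (o : Fin d) (n : ℕ) (x : Fin n → Space d) (a : Space d) :
    (fun i => x i + a) ∈ ordered o n ↔ x ∈ ordered o n := by
  simp [ordered, StrictMono]

/-- Almost every configuration has exactly one labelling by increasing coordinate, so restricting to
these labellings absorbs the 1/k!. Concatenating two clusters, one to the right of the other, then
needs no combinatorial factor. -/
theorem clusterZ_eq_orderedZ (hv : PairPotential d v rhc b) (o : Fin d) (k : ℕ+) :
    clusterZ d v R β k = orderedZ v R β o (k : ℕ) := by
  have hfac : (((k : ℕ)! : ℕ) : ℝ≥0∞) ≠ 0 := by exact_mod_cast (Nat.factorial_pos _).ne'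
  have hfac' : (((k : ℕ)! : ℕ) : ℝ≥0∞) ≠ ⊤ := ENNReal.natCast_ne_top _
  have hA := add_const_mem_ordered o (k : ℕ)
  have h1 := factorial_mul_lintegral_indicator_le measurable_bump lintegral_bump
    (measurable_clusterWeight hv R β k) clusterWeight_add_const clusterWeight_comp_perm
    (measurableSet_ordered o k) hA (fun x σ τ => perm_eq_of_mem_ordered) 0
  have h2 := lintegral_le_factorial_mul_indicator measurable_bump lintegral_bump
    (measurable_clusterWeight hv R β k) clusterWeight_add_const clusterWeight_comp_perm
    (measurableSet_ordered o k) hA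
    ((ae_injective_coord o k).mono fun x hx => exists_perm_mem_ordered hx) 0
  rw [clusterZ_eq_lintegral hv, le_antisymm h2 h1, ← mul_assoc, ENNReal.inv_mul_cancel hfac hfac',
    one_mul, orderedZ]

theorem measurePreserving_append (m n : ℕ) :
    MeasurePreserving
      (fun p : (Fin m → Space d) × (Fin n → Space d) => Fin.append p.1 p.2) := by
  have h1 := volume_measurePreserving_sumPiEquivProdPi_symm
    (fun _ : Fin m ⊕ Fin n => Space d)
  have h2 := volume_measurePreserving_piCongrLeft (fun _ : Fin (m + n) => Space d)
    (finSumFinEquiv : Fin m ⊕ Fin n ≃ Fin (m + n))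
  suffices h : (fun p : (Fin m → Space d) × (Fin n → Space d) => Fin.append p.1 p.2) =
      MeasurableEquiv.piCongrLeft (fun _ : Fin (m + n) => Space d) finSumFinEquiv ∘
        (MeasurableEquiv.sumPiEquivProdPi fun _ : Fin m ⊕ Fin n => Space d).symm by
    rw [h]
    exact h2.comp h1
  ext1 p
  ext1 i
  refine Fin.addCases (fun i => ?_) (fun i => ?_) i
  · rw [Fin.append_left]
    have := MeasurableEquiv.piCongrLeft_apply_apply (β := fun _ : Fin (m + n) => Space d)
      finSumFinEquiv ((MeasurableEquiv.sumPiEquivProdPi fun _ : Fin m ⊕ Fin n => Space d).symm p)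
      (Sum.inl i)
    rw [finSumFinEquiv_apply_left] at this
    exact this.symm
  · rw [Fin.append_right]
    have := MeasurableEquiv.piCongrLeft_apply_apply (β := fun _ : Fin (m + n) => Space d)
      finSumFinEquiv ((MeasurableEquiv.sumPiEquivProdPi fun _ : Fin m ⊕ Fin n => Space d).symm p)
      (Sum.inr i)
    rw [finSumFinEquiv_apply_right] at this
    exact this.symm

theorem isCluster_append {m n : ℕ} {x : Fin m → Space d} {y : Fin n → Space d}
    (hx : IsCluster R x) (hy : IsCluster R y) {i₀ : Fin m} {j₀ : Fin n}
    (h : dist (x i₀) (y j₀) ≤ R) : IsCluster R (Fin.append x y) := by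
  set G := SimpleGraph.fromRel fun i j => dist (Fin.append x y i) (Fin.append x y j) ≤ R with hG
  have hX : ∀ i j, G.Reachable (Fin.castAdd n i) (Fin.castAdd n j) := by
    intro i j
    refine (hx.preconnected i j).map ⟨Fin.castAdd n, fun {a c} hac => ?_⟩
    rw [nearGraph_adj] at hac
    rw [hG, nearGraph_adj, Fin.append_left, Fin.append_left]
    exact ⟨fun h => hac.1 (Fin.castAdd_injective _ _ h), hac.2⟩
  have hY : ∀ i j, G.Reachable (Fin.natAdd m i) (Fin.natAdd m j) := by
    intro i j
    refine (hy.preconnected i j).map ⟨Fin.natAdd m, fun {a c} hac => ?_⟩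
    rw [nearGraph_adj] at hac
    rw [hG, nearGraph_adj, Fin.append_right, Fin.append_right]
    exact ⟨fun h => hac.1 (Fin.natAdd_injective _ _ h), hac.2⟩
  have hXY : G.Reachable (Fin.castAdd n i₀) (Fin.natAdd m j₀) := by
    refine SimpleGraph.Adj.reachable ?_
    rw [hG, nearGraph_adj, Fin.append_left, Fin.append_right]
    refine ⟨fun h => ?_, h⟩
    have := congrArg Fin.val h
    simp at this
    omega
  have hbase : ∀ i, G.Reachable (Fin.castAdd n i₀) i := by
    intro i
    refine Fin.addCases (fun i => hX _ _) (fun j => hXY.trans (hY _ _)) i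
  exact (SimpleGraph.connected_iff_exists_forall_reachable G).2 ⟨_, hbase⟩

/-- The value `⊥` must be excluded: `⊤ + ⊥ = ⊥` would give an infinite weight on the left and 0 on
the right. -/
theorem exp_neg_mul_add {x y : EReal} (hx : x ≠ ⊥) (hy : y ≠ ⊥) (hβ : 0 < β) :
    EReal.exp (-((β : EReal) * (x + y)))
      = EReal.exp (-((β : EReal) * x)) * EReal.exp (-((β : EReal) * y)) := by
  have ht : (β : EReal) * ⊤ = ⊤ := EReal.coe_mul_top_of_pos hβ
  induction x using EReal.rec with
  | bot => exact absurd rfl hx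
  | top => simp [EReal.top_add_of_ne_bot hy, ht]
  | coe x =>
    induction y using EReal.rec with
    | bot => exact absurd rfl hy
    | top => simp [ht]
    | coe y =>
      rw [← EReal.exp_add]
      congr 1
      norm_cast
      ring

theorem mem_ordered_append {m n : ℕ} {o : Fin d} {x : Fin m → Space d} {y : Fin n → Space d}
    (hx : x ∈ ordered o m) (hy : y ∈ ordered o n) (h : ∀ i j, x i o < y j o) :
    Fin.append x y ∈ ordered o (m + n) := by
  intro i j
  refine Fin.addCases (fun i => ?_) (fun i => ?_) i <;>
    refine Fin.addCases (fun j => ?_) (fun j => ?_) j <;>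
    simp only [Fin.append_left, Fin.append_right] <;> intro hij
  · exact hx hij
  · exact h i j
  · simp only [Fin.lt_def, Fin.val_natAdd, Fin.val_castAdd] at hij
    omega
  · exact hy ((Fin.natAdd_lt_natAdd_iff m).1 hij)

/-- A cluster can be attached to the right of another one without interacting with it. -/
theorem orderedZ_mul_le (hv : PairPotential d v rhc b) (hR : (b : ℝ) < R) (hβ : 0 < β)
    (o : Fin d) (m n : ℕ) :
    volume (Metric.ball (0 : Space d) ((R - b) / 4)) *
      (orderedZ v R β o (m + 1) * orderedZ v R β o (n + 1)) ≤
      orderedZ v R β o (m + 1 + (n + 1)) := by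
  -- The first particle of y ranges over a ball of radius ε whose centre lies at distance s along o
  -- from the last particle of x. Since s - ε = (R + 3b)/4 > b, the clusters do not interact; since
  -- s + ε = (3R + b)/4 < R, they are linked.
  let ε : ℝ := (R - b) / 4
  let s : ℝ := (R + b) / 2
  let F : ∀ n : ℕ, (Fin n → Space d) → ℝ≥0∞ := fun n =>
    (ordered o n).indicator (clusterWeight v R β)
  have hF : ∀ n, Measurable (F n) := fun n =>
    (measurable_clusterWeight hv R β n).indicator (measurableSet_ordered o n)
  have hFinv : ∀ n (x : Fin n → Space d) a, F n (fun i => x i + a) = F n x := by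
    classical
    intro n x a
    simp only [F, Set.indicator_apply, clusterWeight_add_const, add_const_mem_ordered]
  let c : Space d → Space d := fun a => a + EuclideanSpace.single o s
  let χ : Space d → Space d → ℝ≥0∞ := fun a => (Metric.ball (c a) ε).indicator fun _ => 1
  have hpt : ∀ (x : Fin (m + 1) → Space d) (y : Fin (n + 1) → Space d),
      F (m + 1) x * (χ (x (Fin.last m)) (y 0) * F (n + 1) y) ≤
        F (m + 1 + (n + 1)) (Fin.append x y) := by
    intro x y
    by_cases hx : x ∈ ordered o (m + 1)
    swap
    · simp [F, hx]
    by_cases hy : y ∈ ordered o (n + 1)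
    swap
    · simp [F, hy]
    by_cases hcx : IsCluster R x
    swap
    · have h0 : F (m + 1) x = 0 :=
        Set.indicator_apply_eq_zero.2 fun _ => clusterWeight_of_not_isCluster hcx
      simp [h0]
    by_cases hcy : IsCluster R y
    swap
    · have h0 : F (n + 1) y = 0 :=
        Set.indicator_apply_eq_zero.2 fun _ => clusterWeight_of_not_isCluster hcy
      simp [h0]
    by_cases hball : y 0 ∈ Metric.ball (c (x (Fin.last m))) ε
    swap
    · simp [χ, hball]
    have hd : dist (y 0) (c (x (Fin.last m))) < ε := hball
    have hco : x (Fin.last m) o + b < y 0 o := by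
      have h1 := (abs_apply_sub_le_dist o _ _).trans_lt hd
      simp only [c, PiLp.add_apply, PiLp.single_apply, if_true] at h1
      have h2 := (abs_lt.1 h1).1
      simp only [ε, s] at h2
      linarith
    have hfar : ∀ i j, x i o + b < y j o := by
      intro i j
      have h1 : x i o ≤ x (Fin.last m) o := (StrictMono.monotone hx) (Fin.le_last i)
      have h2 : y 0 o ≤ y j o := (StrictMono.monotone hy) (Fin.zero_le j)
      linarith
    have hapO : Fin.append x y ∈ ordered o (m + 1 + (n + 1)) :=
      mem_ordered_append hx hy fun i j => by linarith [hfar i j, b.coe_nonneg]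
    have hdist : dist (x (Fin.last m)) (y 0) ≤ R := by
      have h1 : dist (x (Fin.last m)) (c (x (Fin.last m))) = s := by
        have : 0 ≤ s := by simp only [s]; linarith [b.coe_nonneg]
        simp [c, abs_of_nonneg this]
      have h2 := dist_triangle_right (x (Fin.last m)) (y 0) (c (x (Fin.last m)))
      have h3 : s + ε ≤ R := by simp only [s, ε]; linarith
      linarith
    have hapC : IsCluster R (Fin.append x y) := isCluster_append hcx hcy hdist
    have hE : energy v (Fin.append x y) = energy v x + energy v y := by
      refine energy_append hv fun i j => ?_
      rw [← NNReal.coe_lt_coe, coe_nndist, dist_comm]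
      refine lt_of_lt_of_le ?_ ((le_abs_self _).trans (abs_apply_sub_le_dist o _ _))
      linarith [hfar i j]
    have hw : ∀ {n} {z : Fin n → Space d}, z ∈ ordered o n → IsCluster R z →
        F n z = EReal.exp (-((β : EReal) * energy v z)) := by
      intro n z h1 h2
      simp only [F, Set.indicator_of_mem h1, clusterWeight_of_isCluster h2]
    rw [hw hx hcx, hw hy hcy, hw hapO hapC, hE,
      exp_neg_mul_add (energy_ne_bot hv x) (energy_ne_bot hv y) hβ]
    simp [χ, hball]
  have hχ : ∀ a, Measurable (χ a) := fun a => measurable_const.indicator measurableSet_ball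
  have hχint : ∀ a, ∫⁻ z, χ a z = volume (Metric.ball (0 : Space d) ε) := by
    intro a
    rw [lintegral_indicator measurableSet_ball, setLIntegral_const, one_mul,
      Measure.addHaar_ball_center]
  have hpin : ∀ a, ∫⁻ y : Fin (n + 1) → Space d, χ a (y 0) * F (n + 1) y =
      volume (Metric.ball (0 : Space d) ε) * orderedZ v R β o (n + 1) := by
    intro a
    rw [lintegral_apply_zero_mul (hχ a) (hF _) (hFinv _), hχint]
    have := lintegral_apply_zero_mul (measurable_bump (d := d)) (hF (n + 1)) (hFinv _)
    rw [lintegral_bump, one_mul] at this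
    rw [orderedZ, ← this]
  have hmp := measurePreserving_append (d := d) (m + 1) (n + 1)
  have hm : Measurable fun z : Fin (m + 1 + (n + 1)) → Space d => bump d (z 0) * F _ z := by
    have h1 := measurable_bump (d := d)
    have h2 := hF (m + 1 + (n + 1))
    fun_prop
  have hm' := hm.comp hmp.measurable
  simp only [Function.comp_def] at hm'
  have hZ : orderedZ v R β o (m + 1 + (n + 1)) =
      ∫⁻ x : Fin (m + 1) → Space d, ∫⁻ y : Fin (n + 1) → Space d,
        bump d (x 0) * F _ (Fin.append x y) := by
    rw [orderedZ]
    change ∫⁻ z : Fin (m + 1 + (n + 1)) → Space d, bump d (z 0) * F _ z = _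
    rw [← hmp.lintegral_comp hm, Measure.volume_eq_prod, lintegral_prod _ hm'.aemeasurable]
    refine lintegral_congr fun x => lintegral_congr fun y => ?_
    have : Fin.append x y 0 = x 0 := Fin.append_left x y 0
    simp only [this]
  rw [hZ]
  calc volume (Metric.ball (0 : Space d) ε) * (orderedZ v R β o (m + 1) * orderedZ v R β o (n + 1))
      = ∫⁻ x : Fin (m + 1) → Space d, bump d (x 0) * F (m + 1) x *
          (volume (Metric.ball (0 : Space d) ε) * orderedZ v R β o (n + 1)) := by
        have h1 := measurable_bump (d := d)
        have h2 := hF (m + 1)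
        rw [lintegral_mul_const _ (by fun_prop)]
        change _ = orderedZ v R β o (m + 1) * _
        ring
    _ ≤ _ := by
        refine lintegral_mono fun x => ?_
        have h1 := hχ (x (Fin.last m))
        have h2 := hF (n + 1)
        rw [← hpin (x (Fin.last m)), ← lintegral_const_mul _ (by fun_prop)]
        refine lintegral_mono fun y => ?_
        simp only [mul_assoc]
        exact mul_le_mul_right (hpt x y) _

theorem clusterZ_mul_le (hv : PairPotential d v rhc b) (hR : (b : ℝ) < R) (hβ : 0 < β)
    (o : Fin d) (m n : ℕ+) :
    volume (Metric.ball (0 : Space d) ((R - b) / 4)) * (clusterZ d v R β m * clusterZ d v R β n) ≤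
      clusterZ d v R β (m + n) := by
  simp only [clusterZ_eq_orderedZ hv o]
  obtain ⟨i, rfl⟩ : ∃ i : ℕ, m = i.succPNat := ⟨m.natPred, (PNat.succPNat_natPred m).symm⟩
  obtain ⟨j, rfl⟩ : ∃ j : ℕ, n = j.succPNat := ⟨n.natPred, (PNat.succPNat_natPred n).symm⟩
  exact orderedZ_mul_le hv hR hβ o i j

end IdealMixture

/-! ### Tree bound on the partition function and the limit of the free energies -/

namespace IdealMixture

variable {d : ℕ} {v : ℝ≥0 → EReal} {rhc b : ℝ≥0} {R β : ℝ}

/-- The map sending a configuration pinned at the origin to the positions of the parents of its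
particles. -/
def parentMap (d : ℕ) {n : ℕ} (p : Fin n → Fin (n + 1)) :
    (Fin n → Space d) →ₗ[ℝ] (Fin n → Space d) where
  toFun y i := (Fin.cons 0 y : Fin (n + 1) → Space d) (p i)
  map_add' x y := by
    ext1 i
    simp only [Pi.add_apply]
    refine Fin.cases ?_ (fun j => ?_) (p i) <;> simp
  map_smul' c x := by
    ext1 i
    simp only [Pi.smul_apply, RingHom.id_apply]
    refine Fin.cases ?_ (fun j => ?_) (p i) <;> simp

/-- The height h strictly drops towards the root, which sits at 0. The m-th iterate therefore
vanishes at every particle of height at most m. -/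
theorem isNilpotent_parentMap {n : ℕ} {p : Fin n → Fin (n + 1)} {h : Fin (n + 1) → ℕ}
    (hp : ∀ i, h (p i) < h i.succ) : IsNilpotent (parentMap d p) := by
  have key : ∀ (m : ℕ) (y : Fin n → Space d) (i : Fin n), h i.succ ≤ m →
      ((parentMap d p) ^ m) y i = 0 := by
    intro m
    induction m with
    | zero => intro y i hi; have := hp i; omega
    | succ m ih =>
      intro y i hi
      rw [pow_succ', Module.End.mul_apply]
      change (Fin.cons 0 (((parentMap d p) ^ m) y) : Fin (n + 1) → Space d) (p i) = 0
      have hlt := hp i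
      revert hlt
      refine Fin.cases ?_ (fun j => ?_) (p i)
      · simp
      · intro hlt
        rw [Fin.cons_succ]
        exact ih y j (by omega)
  refine ⟨∑ j, h j, LinearMap.ext fun y => funext fun i => key _ y i ?_⟩
  exact Finset.single_le_sum (f := h) (fun _ _ => Nat.zero_le _) (Finset.mem_univ _)

/-- A nilpotent map has characteristic polynomial X^N; its value at 1 is the determinant sought.
Passing to displacements from parents thus preserves volume. -/
theorem det_id_sub_parentMap {n : ℕ} {p : Fin n → Fin (n + 1)} {h : Fin (n + 1) → ℕ}
    (hp : ∀ i, h (p i) < h i.succ) : LinearMap.det (LinearMap.id - parentMap d p) = 1 := by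
  have h1 := IsNilpotent.charpoly_eq_X_pow_finrank (isNilpotent_parentMap (d := d) hp)
  have h2 := congrArg (Polynomial.eval 1) h1
  rw [LinearMap.eval_charpoly] at h2
  rw [map_one, Polynomial.eval_pow, Polynomial.eval_X, one_pow] at h2
  exact h2

/-- The number of connected configurations, as a volume. -/
theorem volume_isCluster_cons_le (R : ℝ) (n : ℕ) :
    volume {y : Fin n → Space d | IsCluster R (Fin.cons (α := fun _ => Space d) 0 y)} ≤
      ((n : ℝ≥0∞) + 1) ^ n * volume (Metric.closedBall (0 : Space d) R) ^ n := by
  classical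
  let S : Finset (Fin n → Fin (n + 1)) :=
    Finset.univ.filter fun p => ∃ h : Fin (n + 1) → ℕ, ∀ i, h (p i) < h i.succ
  let A : (Fin n → Fin (n + 1)) → Set (Fin n → Space d) := fun p =>
    (LinearMap.id - parentMap d p : (Fin n → Space d) →ₗ[ℝ] (Fin n → Space d)) ⁻¹' (Set.univ.pi fun _ => Metric.closedBall 0 R)
  have hsub : {y : Fin n → Space d | IsCluster R (Fin.cons (α := fun _ => Space d) 0 y)} ⊆
      ⋃ p ∈ S, A p := by
    intro y hy
    set x : Fin (n + 1) → Space d := Fin.cons 0 y with hx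
    set G := SimpleGraph.fromRel fun i j => dist (x i) (x j) ≤ R with hG
    have hconn : G.Connected := hy
    -- The parent of a particle is the next vertex on a shortest walk to particle 0, so graph
    -- distance to the root serves as height.
    have hstep : ∀ i : Fin n, ∃ j, G.dist j 0 < G.dist i.succ 0 ∧ dist (x i.succ) (x j) ≤ R := by
      intro i
      obtain ⟨w, hw⟩ := hconn.exists_walk_length_eq_dist i.succ 0
      cases w with
      | cons hadj w' =>
        rename_i j
        refine ⟨j, ?_, ?_⟩
        · rw [← hw, SimpleGraph.Walk.length_cons]
          exact Nat.lt_succ_of_le (SimpleGraph.dist_le w')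
        · rw [hG, nearGraph_adj] at hadj
          exact hadj.2
    choose p hp1 hp2 using hstep
    refine Set.mem_biUnion (x := p) (by simpa [S] using ⟨fun j => G.dist j 0, hp1⟩) ?_
    intro i _
    have := hp2 i
    rw [dist_eq_norm] at this
    rw [mem_closedBall_zero_iff]
    simpa [hx, parentMap] using this
  have hA : ∀ p ∈ S, volume (A p) = volume (Metric.closedBall (0 : Space d) R) ^ n := by
    intro p hp
    obtain ⟨h, hh⟩ : ∃ h : Fin (n + 1) → ℕ, ∀ i, h (p i) < h i.succ := by simpa [S] using hp
    have hdet := det_id_sub_parentMap (d := d) hh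
    have := Measure.addHaar_preimage_linearMap (volume : Measure (Fin n → Space d))
      (f := LinearMap.id - parentMap d p) (by rw [hdet]; exact one_ne_zero)
      (Set.univ.pi fun _ => Metric.closedBall 0 R)
    rw [hdet] at this
    simp only [A]
    rw [this, volume_pi_pi]
    simp
  calc _ ≤ volume (⋃ p ∈ S, A p) := measure_mono hsub
    _ ≤ ∑ p ∈ S, volume (A p) := measure_biUnion_finset_le _ _
    _ = S.card * volume (Metric.closedBall (0 : Space d) R) ^ n := by
        rw [Finset.sum_congr rfl hA, Finset.sum_const, nsmul_eq_mul]
    _ ≤ _ := by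
        refine mul_le_mul_left ?_ _
        have : S.card ≤ (n + 1) ^ n := by
          refine (Finset.card_le_univ S).trans ?_
          simp
        exact_mod_cast this

theorem exp_neg_mul_le {c : ℝ} {e : EReal} (hβ : 0 ≤ β) (h : (c : EReal) ≤ e) :
    EReal.exp (-((β : EReal) * e)) ≤ ENNReal.ofReal (Real.exp (-(β * c))) := by
  have : EReal.exp (-((β : EReal) * c)) = ENNReal.ofReal (Real.exp (-(β * c))) := by
    rw [← EReal.exp_coe]; norm_cast
  rw [← this]
  refine EReal.exp_monotone (EReal.neg_le_neg_iff.2 ?_)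
  exact mul_le_mul_of_nonneg_left h (by exact_mod_cast hβ)

theorem le_exp_neg_mul {c : ℝ} {e : EReal} (hβ : 0 ≤ β) (h : e ≤ c) :
    ENNReal.ofReal (Real.exp (-(β * c))) ≤ EReal.exp (-((β : EReal) * e)) := by
  have : EReal.exp (-((β : EReal) * c)) = ENNReal.ofReal (Real.exp (-(β * c))) := by
    rw [← EReal.exp_coe]; norm_cast
  rw [← this]
  refine EReal.exp_monotone (EReal.neg_le_neg_iff.2 ?_)
  exact mul_le_mul_of_nonneg_left h (by exact_mod_cast hβ)

/-- `Z_k^cl(β) ≤ C^k e^{-β E_k}` with `C` independent of `β` and `k`. -/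
theorem exists_clusterZ_le (hv : PairPotential d v rhc b) (o : Fin d) (R : ℝ) :
    ∃ M : ℝ, ∀ β : ℝ, 0 < β → ∀ k : ℕ+,
      clusterZ d v R β k ≤ ENNReal.ofReal (Real.exp (M * k - β * groundE d v k)) := by
  set V : ℝ := (volume (Metric.closedBall (0 : Space d) R)).toReal with hV
  have hVE : volume (Metric.closedBall (0 : Space d) R) = ENNReal.ofReal V :=
    (ENNReal.ofReal_toReal measure_closedBall_lt_top.ne).symm
  have hV0 : 0 ≤ V := ENNReal.toReal_nonneg
  -- The 1 comes from (n+1)^n / (n+1)! ≤ e^(n+1), by which the factorial absorbs the number of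
  -- parent functions; the V comes from V ≤ e^V.
  refine ⟨1 + V, fun β hβ k => ?_⟩
  obtain ⟨n, rfl⟩ : ∃ n : ℕ, k = n.succPNat := ⟨k.natPred, (PNat.succPNat_natPred k).symm⟩
  set E := groundE d v n.succPNat with hE
  have hint : ∫⁻ y : Fin n → Space d, clusterWeight v R β (Fin.cons (α := fun _ => Space d) 0 y) ≤
      ENNReal.ofReal (Real.exp (-(β * E))) * (((n : ℝ≥0∞) + 1) ^ n * ENNReal.ofReal V ^ n) := by
    rw [← hVE]
    refine le_trans ?_ (mul_le_mul_right (volume_isCluster_cons_le R n) _)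
    rw [← setLIntegral_const]
    refine le_trans (lintegral_mono (g := Set.indicator
      {y : Fin n → Space d | IsCluster R (Fin.cons (α := fun _ => Space d) 0 y)}
      fun _ => ENNReal.ofReal (Real.exp (-(β * E)))) fun y => ?_) (lintegral_indicator_le _ _)
    by_cases hy : IsCluster R (Fin.cons (α := fun _ => Space d) 0 y)
    · rw [clusterWeight_of_isCluster hy, Set.indicator_of_mem (by exact hy)]
      exact exp_neg_mul_le hβ.le (groundE_le hv o n.succPNat _)
    · rw [clusterWeight_of_not_isCluster hy]
      exact zero_le
  have hfac : (((n + 1)! : ℕ) : ℝ≥0∞)⁻¹ = ENNReal.ofReal (((n + 1)! : ℕ) : ℝ)⁻¹ := by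
    rw [ENNReal.ofReal_inv_of_pos (by exact_mod_cast Nat.factorial_pos _), ENNReal.ofReal_natCast]
  have hn1 : ((n : ℝ≥0∞) + 1) = ENNReal.ofReal ((n : ℝ) + 1) := by
    rw [ENNReal.ofReal_add (by positivity) zero_le_one]; simp
  calc clusterZ d v R β n.succPNat
      ≤ (((n + 1)! : ℕ) : ℝ≥0∞)⁻¹ * (ENNReal.ofReal (Real.exp (-(β * E))) *
        (((n : ℝ≥0∞) + 1) ^ n * ENNReal.ofReal V ^ n)) := mul_le_mul_right hint _
    _ = ENNReal.ofReal ((((n + 1)! : ℕ) : ℝ)⁻¹ * (Real.exp (-(β * E)) *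
        (((n : ℝ) + 1) ^ n * V ^ n))) := by
        rw [hfac, hn1, ENNReal.ofReal_mul (by positivity), ENNReal.ofReal_mul (by positivity),
          ENNReal.ofReal_mul (by positivity), ENNReal.ofReal_pow (by positivity),
          ENNReal.ofReal_pow hV0]
    _ ≤ _ := by
        refine ENNReal.ofReal_le_ofReal ?_
        have h1 : ((n : ℝ) + 1) ^ n * ((((n + 1)! : ℕ) : ℝ)⁻¹) ≤ Real.exp (n + 1) := by
          refine le_trans ?_ (Real.pow_div_factorial_le_exp ((n : ℝ) + 1) (by positivity) (n + 1))
          rw [div_eq_mul_inv]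
          refine mul_le_mul_of_nonneg_right ?_ (by positivity)
          exact pow_le_pow_right₀ (by linarith [(Nat.cast_nonneg n : (0 : ℝ) ≤ n)]) (Nat.le_succ n)
        have h2 : V ^ n ≤ Real.exp (V * (n + 1)) := by
          calc V ^ n ≤ Real.exp V ^ n :=
                pow_le_pow_left₀ hV0 (by linarith [Real.add_one_le_exp V]) n
            _ = Real.exp (V * n) := by rw [← Real.exp_nat_mul, mul_comm]
            _ ≤ _ := Real.exp_le_exp.2 (by nlinarith)
        have h3 : Real.exp ((1 + V) * (n.succPNat : ℕ) - β * E) =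
            Real.exp (n + 1) * Real.exp (V * (n + 1)) * Real.exp (-(β * E)) := by
          rw [← Real.exp_add, ← Real.exp_add]
          congr 1
          simp only [Nat.succPNat_coe, Nat.succ_eq_add_one]
          push_cast
          ring
        rw [h3]
        calc _ = (((n : ℝ) + 1) ^ n * ((((n + 1)! : ℕ) : ℝ)⁻¹)) * V ^ n * Real.exp (-(β * E)) := by
              ring
          _ ≤ _ := by gcongr

theorem clusterZ_ne_top (hv : PairPotential d v rhc b) (o : Fin d) (hβ : 0 < β) (k : ℕ+) :
    clusterZ d v R β k ≠ ⊤ := by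
  obtain ⟨M, hM⟩ := exists_clusterZ_le hv o R
  exact ((hM β hβ k).trans_lt ENNReal.ofReal_lt_top).ne

theorem clusterZ_one : clusterZ d v R β 1 = 1 := by
  have h : ∀ x : Fin (0 + 1) → Space d, clusterWeight v R β x = 1 := by
    intro x
    have hx : IsCluster R x :=
      (SimpleGraph.connected_iff_exists_forall_reachable _).2 ⟨0, fun w => by
        rw [Fin.fin_one_eq_zero w]⟩
    rw [clusterWeight_of_isCluster hx]
    simp [energy]
  rw [clusterZ]
  have h' : ∀ y : Fin (PNat.natPred 1) → Space d,
      clusterWeight v R β (Fin.cons (α := fun _ => Space d) 0 y) = 1 := fun y => h _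
  simp only [h']
  have : IsEmpty (Fin (PNat.natPred 1)) := Fin.isEmpty
  simp [volume_pi]

/-- Particles are attached one at a time by supermultiplicativity, starting from Z_1 = 1. -/
theorem clusterZ_ne_zero (hv : PairPotential d v rhc b) (hR : (b : ℝ) < R) (hβ : 0 < β)
    (o : Fin d) (k : ℕ+) : clusterZ d v R β k ≠ 0 := by
  induction k using PNat.recOn with
  | one => rw [clusterZ_one]; exact one_ne_zero
  | succ k ih =>
    have h := clusterZ_mul_le hv hR hβ o k 1
    rw [clusterZ_one, mul_one] at h
    refine (lt_of_lt_of_le (ENNReal.mul_pos ?_ ih) h).ne'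
    exact (Metric.measure_ball_pos volume _ (by linarith)).ne'

theorem clusterZ_toReal_pos (hv : PairPotential d v rhc b) (hR : (b : ℝ) < R) (hβ : 0 < β)
    (o : Fin d) (k : ℕ+) : 0 < (clusterZ d v R β k).toReal :=
  ENNReal.toReal_pos (clusterZ_ne_zero hv hR hβ o k) (clusterZ_ne_top hv o hβ k)

theorem mul_clusterF (hβ : 0 < β) (k : ℕ+) :
    β * k * clusterF d v R β k = -Real.log (clusterZ d v R β k).toReal := by
  have : (0 : ℝ) < k := by exact_mod_cast k.pos
  rw [clusterF]
  field_simp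

/-- `f_k^cl(β) ≥ E_k / k - M / β`. -/
theorem exists_le_clusterF (hv : PairPotential d v rhc b) (o : Fin d) (hR : (b : ℝ) < R) :
    ∃ M : ℝ, ∀ β : ℝ, 0 < β → ∀ k : ℕ+,
      β * groundE d v k - M * k ≤ β * k * clusterF d v R β k := by
  obtain ⟨M, hM⟩ := exists_clusterZ_le hv o R
  refine ⟨M, fun β hβ k => ?_⟩
  have h := ENNReal.toReal_mono ENNReal.ofReal_ne_top (hM β hβ k)
  rw [ENNReal.toReal_ofReal (Real.exp_pos _).le,
    ← Real.log_le_iff_le_exp (clusterZ_toReal_pos hv hR hβ o k)] at h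
  rw [mul_clusterF hβ]
  linarith

theorem clusterF_le_of_le_clusterZ (hv : PairPotential d v rhc b) (o : Fin d) (hβ : 0 < β)
    {k : ℕ+} {c : ℝ} (h : ENNReal.ofReal (Real.exp c) ≤ clusterZ d v R β k) :
    β * k * clusterF d v R β k ≤ -c := by
  have h := ENNReal.toReal_mono (clusterZ_ne_top hv o hβ k) h
  rw [ENNReal.toReal_ofReal (Real.exp_pos _).le] at h
  rw [mul_clusterF hβ, neg_le_neg_iff, Real.le_log_iff_exp_le (lt_of_lt_of_le (Real.exp_pos _) h)]
  exact h

/-- With c the ball volume in `clusterZ_mul_le`, the sequence -log Z_k - log c is subadditive, and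
the tree bound together with stability bounds it below linearly in k. Fekete's lemma applies, and
log c / k disappears in the limit. -/
theorem tendsto_clusterF (hv : PairPotential d v rhc b) (o : Fin d) (hR : (b : ℝ) < R)
    (hβ : 0 < β) : Tendsto (clusterF d v R β) atTop (𝓝 (clusterFInf d v R β)) := by
  set c : ℝ := (volume (Metric.ball (0 : Space d) ((R - b) / 4))).toReal with hc
  have hc0 : 0 < c := ENNReal.toReal_pos (Metric.measure_ball_pos volume _ (by linarith)).ne'
    measure_ball_lt_top.ne
  obtain ⟨M, hM⟩ := exists_le_clusterF hv o hR
  obtain ⟨B, hB⟩ := exists_le_groundE hv o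
  let u : ℕ+ → ℝ := fun k => β * k * clusterF d v R β k - Real.log c
  have hsub : ∀ m n, u (m + n) ≤ u m + u n := by
    intro m n
    have h := ENNReal.toReal_mono (clusterZ_ne_top hv o hβ (m + n)) (clusterZ_mul_le hv hR hβ o m n)
    have hm := clusterZ_toReal_pos hv hR hβ o m
    have hn := clusterZ_toReal_pos hv hR hβ o n
    rw [ENNReal.toReal_mul, ENNReal.toReal_mul] at h
    have h' := Real.log_le_log (by positivity) h
    rw [Real.log_mul hc0.ne' (by positivity), Real.log_mul hm.ne' hn.ne'] at h'
    simp only [u, mul_clusterF hβ]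
    linarith
  have hbd : ∀ k : ℕ+, -((β * B + M + |Real.log c|) * k) ≤ u k := by
    intro k
    have h1 := hM β hβ k
    have h2 := mul_le_mul_of_nonneg_left (hB k) hβ.le
    have h3 : (1 : ℝ) ≤ k := by exact_mod_cast one_le (a := k)
    have h4 := le_abs_self (Real.log c)
    have h5 := mul_le_mul_of_nonneg_left h3 (abs_nonneg (Real.log c))
    simp only [u]
    linarith
  obtain ⟨l, hl, -⟩ := tendsto_div_of_subadditive hsub hbd
  have hk : Tendsto (fun k : ℕ+ => Real.log c / (k : ℝ)) atTop (𝓝 0) :=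
    (tendsto_const_div_atTop_nhds_zero_nat (Real.log c)).comp tendsto_PNat_val_atTop_atTop
  have hlim : Tendsto (clusterF d v R β) atTop (𝓝 (β⁻¹ * (l + 0))) := by
    refine ((hl.add hk).const_mul β⁻¹).congr fun k => ?_
    have : (0 : ℝ) < k := by exact_mod_cast k.pos
    simp only [u]
    field_simp
    ring
  have : clusterFInf d v R β = β⁻¹ * (l + 0) := hlim.limUnder_eq
  rw [this]
  exact hlim

end IdealMixture

/-! ### Lower bounds on the partition function from near-minimisers -/

namespace IdealMixture

variable {d : ℕ} {v : ℝ≥0 → EReal} {rhc b : ℝ≥0} {R β : ℝ}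

theorem PairPotential.continuousAt_toReal (hv : PairPotential d v rhc b) {r : ℝ≥0}
    (hr : rhc < r) : ContinuousAt (fun r => (v r).toReal) r := by
  have h1 : ContinuousAt v r := by
    refine hv.continuousOn.continuousAt ?_
    filter_upwards [lt_mem_nhds hr] with s hs
    exact ⟨hs.le, bot_le.trans_lt hs⟩
  have h2 := hv.finite r hr
  exact (EReal.tendsto_toReal h2.1 h2.2).comp h1

/-- At finite energy all distances exceed the hard-core radius, where v is finite and continuous. -/
theorem eventually_energy_lt (hv : PairPotential d v rhc b) {n : ℕ} {x : Fin n → Space d} {c : ℝ}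
    (h : energy v x < c) : ∀ᶠ y in 𝓝 x, energy v y < c := by
  have htop : energy v x ≠ ⊤ := (h.trans (EReal.coe_lt_top c)).ne
  have hsep : ∀ i j, i ≠ j → rhc < nndist (x i) (x j) := fun i j hij =>
    lt_nndist_of_energy_ne_top hv htop hij
  have hcont : ∀ i j, ContinuousAt (fun y : Fin n → Space d => nndist (y i) (y j)) x := by
    intro i j
    fun_prop
  have hsep' : ∀ᶠ y : Fin n → Space d in 𝓝 x, ∀ i j, i ≠ j → rhc < nndist (y i) (y j) := by
    refine eventually_all.2 fun i => eventually_all.2 fun j => ?_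
    by_cases hij : i = j
    · simp [hij]
    · filter_upwards [(hcont i j).eventually (lt_mem_nhds (hsep i j hij))] with y hy _ using hy
  have hreal : ContinuousAt (fun y : Fin n → Space d => realEnergy v y) x := by
    refine tendsto_finsetSum _ fun i _ => tendsto_finsetSum _ fun j hj => ?_
    exact ContinuousAt.comp (g := fun r => (v r).toReal)
      (hv.continuousAt_toReal (hsep i j (Finset.mem_Ioi.1 hj).ne)) (hcont i j)
  rw [energy_eq_coe_realEnergy hv hsep, EReal.coe_lt_coe_iff] at h
  filter_upwards [hsep', hreal.eventually (gt_mem_nhds h)] with y hy1 hy2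
  rw [energy_eq_coe_realEnergy hv hy1, EReal.coe_lt_coe_iff]
  exact hy2

theorem eventually_isCluster {n : ℕ} {x : Fin n → Space d} {S : ℝ} (hx : IsCluster S x)
    (hS : S < R) : ∀ᶠ y in 𝓝 x, IsCluster R y := by
  have : ∀ᶠ y : Fin n → Space d in 𝓝 x, ∀ i j, dist (x i) (x j) ≤ S → dist (y i) (y j) ≤ R := by
    refine eventually_all.2 fun i => eventually_all.2 fun j => ?_
    by_cases h : dist (x i) (x j) ≤ S
    · have hc : ContinuousAt (fun y : Fin n → Space d => dist (y i) (y j)) x := by fun_prop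
      filter_upwards [hc.eventually (gt_mem_nhds (h.trans_lt hS))] with y hy _ using hy.le
    · simp [h]
  filter_upwards [this] with y hy using hx.mono hy

/-- For a fixed number of particles, the cluster free energy is asymptotically at most the
ground state energy. -/
theorem eventually_clusterF_le (hv : PairPotential d v rhc b) (o : Fin d) (hR : (b : ℝ) < R)
    (k : ℕ+) {ε : ℝ} (hε : 0 < ε) :
    ∀ᶠ β : ℝ in atTop, clusterF d v R β k ≤ groundE d v k / k + ε := by
  obtain ⟨n, rfl⟩ : ∃ n : ℕ, k = n.succPNat := ⟨k.natPred, (PNat.succPNat_natPred k).symm⟩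
  set E := groundE d v n.succPNat with hE
  obtain ⟨x, hx⟩ := exists_energy_lt hv o n.succPNat (c := E + ε / 2) (by linarith)
  -- Connecting at the smaller range (b + R)/2 makes connectedness at range R survive small
  -- perturbations.
  obtain ⟨y, hyC, hyE⟩ := exists_isCluster_energy_eq hv o (R := (b + R) / 2) (by linarith) x
  let y' : Fin (n + 1) → Space d := fun i => y i + -y 0
  have hy' : (Fin.cons 0 (Fin.tail y') : Fin (n + 1) → Space d) = y' := by
    have : y' 0 = 0 := add_neg_cancel (y 0)
    rw [← this, Fin.cons_self_tail]
  have hy'C : IsCluster ((b + R) / 2) y' := (isCluster_add_const (n := n + 1) y _).2 hyC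
  have hy'E : energy v y' < ((E + ε / 2 : ℝ) : EReal) := by
    have : energy v y' = energy v y := energy_add_const (n := n + 1) y _
    rw [this, hyE]
    exact hx
  have hcons : Continuous fun w : Fin n → Space d => (Fin.cons 0 w : Fin (n + 1) → Space d) := by
    refine continuous_pi fun i => ?_
    refine Fin.cases ?_ (fun j => ?_) i
    · simpa using continuous_const
    · simpa using continuous_apply j
  have htend := hcons.tendsto (Fin.tail y')
  rw [hy'] at htend
  have hnhds := htend.eventually
    ((eventually_energy_lt hv hy'E).and (eventually_isCluster (R := R) hy'C (by linarith)))
  obtain ⟨r, hr, hball⟩ := Metric.eventually_nhds_iff_ball.1 hnhds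
  set V := volume (Metric.ball (Fin.tail y') r) with hV
  have hV0 : 0 < V.toReal := ENNReal.toReal_pos (Metric.measure_ball_pos volume _ hr).ne'
    measure_ball_lt_top.ne
  have hfac : (0 : ℝ) < ((n + 1)! : ℕ) := by exact_mod_cast Nat.factorial_pos _
  have hn : (1 : ℝ) ≤ (n.succPNat : ℕ) := by exact_mod_cast one_le (a := n.succPNat)
  set c := V.toReal / ((n + 1)! : ℕ) with hc
  have hc0 : 0 < c := by positivity
  -- Half of ε pays for the near-minimiser, the other half for the β-independent volume factor c.
  filter_upwards [eventually_gt_atTop 0, eventually_ge_atTop (-Real.log c / (ε / 2))]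
    with β hβ hβ2
  have hZ : ENNReal.ofReal (Real.exp (-(β * (E + ε / 2)) + Real.log c)) ≤
      clusterZ d v R β n.succPNat := by
    rw [Real.exp_add, Real.exp_log hc0, hc, div_eq_inv_mul V.toReal,
      ENNReal.ofReal_mul (Real.exp_pos _).le, ENNReal.ofReal_mul (inv_nonneg.2 hfac.le), ENNReal.ofReal_inv_of_pos hfac, ENNReal.ofReal_natCast,
      ENNReal.ofReal_toReal measure_ball_lt_top.ne, ← mul_assoc, mul_comm (ENNReal.ofReal _),
      mul_assoc, clusterZ]
    refine mul_le_mul_right ?_ _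
    rw [← setLIntegral_const]
    refine le_trans ?_ (setLIntegral_le_lintegral (Metric.ball (Fin.tail y') r) _)
    refine setLIntegral_mono' measurableSet_ball fun w hw => ?_
    have h := hball w hw
    exact (le_exp_neg_mul hβ.le h.1.le).trans (clusterWeight_of_isCluster (β := β) h.2).ge
  have h := clusterF_le_of_le_clusterZ hv o hβ hZ
  rw [div_le_iff₀ (by positivity)] at hβ2
  have hkk : (0 : ℝ) < (n.succPNat : ℕ) := by linarith
  have hE' : E / (n.succPNat : ℕ) + ε = (E + (n.succPNat : ℕ) * ε) / (n.succPNat : ℕ) := by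
    field_simp
  rw [hE', le_div_iff₀ hkk]
  refine le_of_mul_le_mul_left ?_ hβ
  have h5 : β * ε ≤ (n.succPNat : ℕ) * (β * ε) := le_mul_of_one_le_left (by positivity) hn
  linarith

/-- A bound on the number of neighbours in a separated configuration. -/
theorem exists_card_neighbours_le (d : ℕ) (b : ℝ) {r : ℝ} (hr : 0 < r) :
    ∃ N : ℕ, ∀ (n : ℕ) (x : Fin n → Space d), (∀ i j, i ≠ j → r ≤ dist (x i) (x j)) →
      ∀ i, (Finset.univ.filter fun j => dist (x i) (x j) ≤ b).card ≤ N := by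
  -- Each ball of radius r/2 in a cover of the b-ball contains at most one particle.
  obtain ⟨t, -, htf, ht⟩ :=
    (isCompact_closedBall (0 : Space d) b).finite_cover_balls (half_pos hr)
  refine ⟨htf.toFinset.card, fun n x hx i => ?_⟩
  have hex : ∀ j, ∃ c : Space d, dist (x i) (x j) ≤ b → c ∈ t ∧ dist (x j - x i) c < r / 2 := by
    intro j
    by_cases h : dist (x i) (x j) ≤ b
    · have : x j - x i ∈ Metric.closedBall (0 : Space d) b := by
        rw [mem_closedBall_zero_iff, ← dist_eq_norm, dist_comm]; exact h
      obtain ⟨c, hc, hc'⟩ := Set.mem_iUnion₂.1 (ht this)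
      exact ⟨c, fun _ => ⟨hc, hc'⟩⟩
    · exact ⟨0, fun h' => absurd h' h⟩
  choose c hc using hex
  refine Finset.card_le_card_of_injOn c (fun j hj => ?_) fun j hj l hl hjl => ?_
  · simp only [Finset.coe_filter, Finset.mem_univ, true_and, Set.mem_ofPred_eq] at hj
    simpa using (hc j hj).1
  · simp only [Finset.coe_filter, Finset.mem_univ, true_and, Set.mem_ofPred_eq] at hj hl
    by_contra hne
    have h1 := (hc j hj).2
    have h2 := (hc l hl).2
    rw [← hjl] at h2
    have h3 := dist_triangle_right (x j - x i) (x l - x i) (c j)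
    rw [dist_sub_right] at h3
    linarith [hx j l hne]

/-- A dilated and slightly perturbed separated configuration of low energy contributes its
Boltzmann weight to the cluster partition function. -/
theorem le_clusterZ_of_perturbation (hv : PairPotential d v rhc b) (hβ : 0 < β)
    {r η δ S : ℝ} (hη : 0 < η) (hηr : 4 * η < r) (hrr : (rhc : ℝ) < r) (hδ0 : 0 ≤ δ)
    (hS : S + 2 * η * (S / r + 1) ≤ R) {n N : ℕ} {x : Fin (n + 1) → Space d}
    (hsep : ∀ i j, i ≠ j → r ≤ dist (x i) (x j)) (hx : IsCluster S x)
    (hN : ∀ i, (Finset.univ.filter fun j => dist (x i) (x j) ≤ b).card ≤ N)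
    (hδ : ∀ s t : ℝ≥0, r ≤ s → s ≤ t → (s : ℝ) ≤ b → (t : ℝ) ≤ s + 2 * η * (b / r + 1) →
      (v t).toReal ≤ (v s).toReal + δ) :
    ENNReal.ofReal (Real.exp (-(β * (realEnergy v x + (n + 1) * (N * δ))))) *
      volume (Metric.closedBall (0 : Space d) η) ^ n ≤ clusterZ d v R β n.succPNat := by
  have hr0 : 0 < r := by linarith
  -- The dilation compensates the perturbation: t·D - 2η ≥ D once D ≥ r, so no distance shrinks. The
  -- hard core is avoided and pairs beyond b stay beyond b; only the at most N neighbours of each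
  -- particle can raise the energy, each by at most δ.
  let t : ℝ := 1 + 2 * η / r
  have ht0 : 0 ≤ t := by positivity
  let A : Set (Fin (n + 1) → Space d) := {y | ∀ i, dist (y i - y 0) (t • (x i - x 0)) ≤ η}
  have hAmeas : MeasurableSet A := by
    have : A = ⋂ i, {y : Fin (n + 1) → Space d | dist (y i - y 0) (t • (x i - x 0)) ≤ η} := by
      ext y; simp [A]
    rw [this]
    exact MeasurableSet.iInter fun i => measurableSet_le (by fun_prop) measurable_const
  have hAinv : ∀ (y : Fin (n + 1) → Space d) a, (fun i => y i + a) ∈ A ↔ y ∈ A := by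
    intro y a
    simp only [A, Set.mem_ofPred_eq, add_sub_add_right_eq_sub]
  have hgeo : ∀ y ∈ A, ∀ i j, |dist (y i) (y j) - t * dist (x i) (x j)| ≤ 2 * η := by
    intro y hy i j
    have h1 := hy i
    have h2 := hy j
    rw [dist_eq_norm] at h1 h2
    have h3 : t * dist (x i) (x j) = ‖t • (x i - x j)‖ := by
      rw [norm_smul, Real.norm_of_nonneg ht0, dist_eq_norm]
    rw [h3, dist_eq_norm]
    refine (abs_norm_sub_norm_le _ _).trans ?_
    have h4 : y i - y j - t • (x i - x j) =
        (y i - y 0 - t • (x i - x 0)) - (y j - y 0 - t • (x j - x 0)) := by module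
    rw [h4]
    refine (norm_sub_le _ _).trans ?_
    linarith
  have hlow : ∀ y ∈ A, ∀ i j, i ≠ j → dist (x i) (x j) ≤ dist (y i) (y j) := by
    intro y hy i j hij
    have h1 := (abs_le.1 (hgeo y hy i j)).1
    have h2 : 2 * η ≤ 2 * η / r * dist (x i) (x j) := by
      rw [div_mul_eq_mul_div, le_div_iff₀ hr0]
      exact mul_le_mul_of_nonneg_left (hsep i j hij) (by positivity)
    simp only [t] at h1
    linarith
  have hup : ∀ y ∈ A, ∀ i j,
      dist (y i) (y j) ≤ dist (x i) (x j) + 2 * η * (dist (x i) (x j) / r + 1) := by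
    intro y hy i j
    have h1 := (abs_le.1 (hgeo y hy i j)).2
    have h2 : t * dist (x i) (x j) + 2 * η =
        dist (x i) (x j) + 2 * η * (dist (x i) (x j) / r + 1) := by
      simp only [t]; field_simp; ring
    linarith
  have hdisj : ∀ (y : Fin (n + 1) → Space d) (σ τ : Equiv.Perm (Fin (n + 1))),
      y ∘ σ ∈ A → y ∘ τ ∈ A → σ = τ := by
    intro y σ τ hσ hτ
    have hsepy : ∀ i j, i ≠ j → r ≤ dist (y i) (y j) := by
      intro i j hij
      have h1 : σ.symm i ≠ σ.symm j := fun h => hij (σ.symm.injective h)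
      have h2 := (hsep _ _ h1).trans (hlow _ hσ _ _ h1)
      simpa using h2
    -- The sum of all y i does not depend on the labelling, so averaging the defining inequalities
    -- of A locates y (σ 0) and y (τ 0) within 2η of each other. Then y (σ i) and y (τ i) differ by
    -- at most 4η < r and must be the same particle. Disjoint relabellings of A cancel the factorial
    -- in Z.
    let T : Space d := ∑ i, t • (x i - x 0)
    have hsum : ∀ ρ : Equiv.Perm (Fin (n + 1)), y ∘ ρ ∈ A →
        ‖∑ i, y i - (n + 1 : ℝ) • y (ρ 0) - T‖ ≤ (n + 1) * η := by
      intro ρ hρ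
      have h1 : ∑ i, y i - (n + 1 : ℝ) • y (ρ 0) - T =
          ∑ i, (y (ρ i) - y (ρ 0) - t • (x i - x 0)) := by
        rw [Finset.sum_sub_distrib, Finset.sum_sub_distrib, Equiv.sum_comp ρ y, Finset.sum_const,
          Finset.card_univ, Fintype.card_fin, ← Nat.cast_smul_eq_nsmul ℝ]
        push_cast
        rfl
      rw [h1]
      refine (norm_sum_le_of_le _ (f := fun i => y (ρ i) - y (ρ 0) - t • (x i - x 0))
        (n := fun _ => η) fun i _ => ?_).trans ?_
      · have := hρ i
        rwa [dist_eq_norm] at this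
      · simp
    have h0 : ‖y (σ 0) - y (τ 0)‖ ≤ 2 * η := by
      have hn : (0 : ℝ) < (n : ℝ) + 1 := by positivity
      have h1 : (n + 1 : ℝ) • (y (σ 0) - y (τ 0)) = (∑ i, y i - (n + 1 : ℝ) • y (τ 0) - T) -
          (∑ i, y i - (n + 1 : ℝ) • y (σ 0) - T) := by module
      have h2 : ‖(n + 1 : ℝ) • (y (σ 0) - y (τ 0))‖ ≤ (n + 1) * η + (n + 1) * η := by
        rw [h1]
        exact (norm_sub_le _ _).trans (add_le_add (hsum τ hτ) (hsum σ hσ))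
      rw [norm_smul, Real.norm_of_nonneg hn.le] at h2
      refine le_of_mul_le_mul_left ?_ hn
      linarith
    ext i : 1
    by_contra hne
    have h1 := hsepy _ _ hne
    have h2 := hσ i
    have h3 := hτ i
    rw [dist_eq_norm] at h1 h2 h3
    simp only [Function.comp_apply] at h2 h3
    have h4 : y (σ i) - y (τ i) = (y (σ i) - y (σ 0) - t • (x i - x 0)) -
      (y (τ i) - y (τ 0) - t • (x i - x 0)) + (y (σ 0) - y (τ 0)) := by module
    rw [h4] at h1
    have h5 := norm_add_le ((y (σ i) - y (σ 0) - t • (x i - x 0)) -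
      (y (τ i) - y (τ 0) - t • (x i - x 0))) (y (σ 0) - y (τ 0))
    have h6 := norm_sub_le (y (σ i) - y (σ 0) - t • (x i - x 0))
      (y (τ i) - y (τ 0) - t • (x i - x 0))
    linarith
  have hcl : ∀ y ∈ A, IsCluster R y := by
    intro y hy
    refine hx.mono fun i j hij => (hup y hy i j).trans (le_trans ?_ hS)
    gcongr
  have hen : ∀ y ∈ A, energy v y ≤ ((realEnergy v x + (n + 1) * (N * δ) : ℝ) : EReal) := by
    intro y hy
    have hysep : ∀ i j, i ≠ j → rhc < nndist (y i) (y j) := by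
      intro i j hij
      rw [← NNReal.coe_lt_coe, coe_nndist]
      exact hrr.trans_le ((hsep i j hij).trans (hlow y hy i j hij))
    rw [energy_eq_coe_realEnergy hv hysep, EReal.coe_le_coe_iff]
    have hterm : ∀ i, ∀ j ∈ Finset.Ioi i, (v (nndist (y i) (y j))).toReal ≤
        (v (nndist (x i) (x j))).toReal + if dist (x i) (x j) ≤ b then δ else 0 := by
      intro i j hj
      have hij : i ≠ j := (Finset.mem_Ioi.1 hj).ne
      have hle := hlow y hy i j hij
      split_ifs with hb
      · refine hδ _ _ (by simpa using hsep i j hij) (by exact_mod_cast hle) (by simpa using hb) ?_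
        rw [coe_nndist, coe_nndist]
        refine (hup y hy i j).trans ?_
        gcongr
      · push Not at hb
        rw [hv.eq_zero_of_lt, hv.eq_zero_of_lt]
        · simp
        · rw [← NNReal.coe_lt_coe, coe_nndist]; exact hb
        · rw [← NNReal.coe_lt_coe, coe_nndist]; exact hb.trans_le hle
    calc realEnergy v y
        ≤ ∑ i, ∑ j ∈ Finset.Ioi i, ((v (nndist (x i) (x j))).toReal +
            if dist (x i) (x j) ≤ b then δ else 0) :=
          Finset.sum_le_sum fun i _ => Finset.sum_le_sum fun j hj => hterm i j hj
      _ = realEnergy v x + ∑ i, ∑ j ∈ Finset.Ioi i, (if dist (x i) (x j) ≤ b then δ else 0) := by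
          simp only [Finset.sum_add_distrib, realEnergy]
      _ ≤ _ := by
          gcongr
          have : ∀ i : Fin (n + 1), ∑ j ∈ Finset.Ioi i, (if dist (x i) (x j) ≤ b then δ else 0)
              ≤ N * δ := by
            intro i
            refine (Finset.sum_le_sum_of_subset_of_nonneg (Finset.subset_univ _)
              fun _ _ _ => by split_ifs <;> simp [hδ0]).trans ?_
            rw [← Finset.sum_filter, Finset.sum_const, nsmul_eq_mul]
            exact mul_le_mul_of_nonneg_right (by exact_mod_cast hN i) hδ0
          refine (Finset.sum_le_sum fun i _ => this i).trans ?_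
          simp
  have hfac : (((n + 1)! : ℕ) : ℝ≥0∞) ≠ 0 := by exact_mod_cast (Nat.factorial_pos _).ne'
  have hfac' : (((n + 1)! : ℕ) : ℝ≥0∞) ≠ ⊤ := ENNReal.natCast_ne_top _
  have hZ : ∫⁻ y : Fin (n + 1) → Space d, bump d (y 0) * A.indicator (clusterWeight v R β) y ≤
      clusterZ d v R β n.succPNat := by
    have h := factorial_mul_lintegral_indicator_le measurable_bump lintegral_bump
      (measurable_clusterWeight hv R β (n + 1)) clusterWeight_add_const clusterWeight_comp_perm
      hAmeas hAinv hdisj 0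
    rw [clusterZ_eq_lintegral hv]
    have h' := mul_le_mul_right h (((n + 1)! : ℕ) : ℝ≥0∞)⁻¹
    rw [← mul_assoc, ENNReal.inv_mul_cancel hfac hfac', one_mul] at h'
    exact h'
  refine le_trans ?_ hZ
  have hone := lintegral_apply_zero_mul (measurable_bump (d := d))
    ((measurable_const (a := (1 : ℝ≥0∞))).indicator hAmeas)
    (fun y a => by classical simp only [Set.indicator_apply, hAinv])
  have hvol : ∫⁻ w : Fin n → Space d, A.indicator (fun _ => (1 : ℝ≥0∞)) (Fin.cons 0 w) =
      volume (Metric.closedBall (0 : Space d) η) ^ n := by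
    classical
    have hset : ∀ w : Fin n → Space d, A.indicator (fun _ => (1 : ℝ≥0∞)) (Fin.cons 0 w) =
        (Set.univ.pi fun i : Fin n => Metric.closedBall (t • (x i.succ - x 0)) η).indicator 1 w := by
      intro w
      have : (Fin.cons 0 w : Fin (n + 1) → Space d) ∈ A ↔
          w ∈ Set.univ.pi fun i : Fin n => Metric.closedBall (t • (x i.succ - x 0)) η := by
        simp only [A, Set.mem_ofPred_eq, Fin.forall_fin_succ, Fin.cons_zero, Fin.cons_succ,
          Set.mem_univ_pi, Metric.mem_closedBall, sub_self, smul_zero, dist_self, sub_zero,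
          hη.le, true_and]
      simp only [Set.indicator_apply, this, Pi.one_apply]
    simp only [hset]
    rw [lintegral_indicator_one (MeasurableSet.univ_pi fun i => measurableSet_closedBall),
      volume_pi_pi]
    simp only [Measure.addHaar_closedBall_center, Finset.prod_const, Finset.card_univ,
      Fintype.card_fin]
  rw [lintegral_bump, one_mul, hvol] at hone
  have hmeas : Measurable fun y : Fin (n + 1) → Space d =>
      bump d (y 0) * A.indicator (fun _ => (1 : ℝ≥0∞)) y := by
    have h1 := measurable_bump (d := d)
    have h2 : Measurable (A.indicator fun _ => (1 : ℝ≥0∞)) := measurable_const.indicator hAmeas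
    fun_prop
  rw [← hone, ← lintegral_const_mul _ hmeas]
  refine lintegral_mono fun y => ?_
  by_cases hy : y ∈ A
  · rw [Set.indicator_of_mem hy, Set.indicator_of_mem hy, mul_one, mul_comm,
      clusterWeight_of_isCluster (hcl y hy)]
    exact mul_le_mul_right (le_exp_neg_mul hβ.le (hen y hy)) _
  · simp [hy]

end IdealMixture

/-! ### Low-temperature bound on the limiting free energy -/

namespace IdealMixture

variable {d : ℕ} {v : ℝ≥0 → EReal} {rhc b : ℝ≥0} {R β : ℝ}

/-- Every ground state can be replaced by a connected one. -/
theorem exists_isCluster_groundState (hv : PairPotential d v rhc b) (o : Fin d)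
    (hR : (b : ℝ) < R) (k : ℕ+) (h : ∃ x : Fin k → Space d, IsGroundState v x) :
    ∃ x : Fin k → Space d, IsGroundState v x ∧ IsCluster R x ∧ energy v x = groundE d v k := by
  obtain ⟨x, hx⟩ := h
  obtain ⟨y, hy, hyE⟩ := exists_isCluster_energy_eq hv o hR x
  have hyG : IsGroundState v y := fun z => hyE.le.trans (hx z)
  refine ⟨y, hyG, hy, ?_⟩
  rw [coe_groundE hv o]
  exact le_antisymm (le_iInf hyG) (iInf_le _ y)

/-- `f_∞^cl(β) ≤ e_∞ + O(log β / β)`. -/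
theorem exists_clusterFInf_le (hv : PairPotential d v rhc b) (o : Fin d) (hR : (b : ℝ) < R)
    (hH : HolderHypothesis d v rhc)
    (hgs : ∀ k : ℕ+, ∃ x : Fin k → Space d, IsGroundState v x) :
    ∃ D a : ℝ, ∀ᶠ β : ℝ in atTop,
      β * clusterFInf d v R β ≤ β * groundEInf d v + (D + a * Real.log β) := by
  obtain ⟨r, hr, ⟨C, α, hα, -, hHol⟩, hmin⟩ := hH
  have hr0 : (0 : ℝ) < r := by exact_mod_cast bot_le.trans_lt hr
  have hα0 : (0 : ℝ) < α := by exact_mod_cast hα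
  obtain ⟨N, hN⟩ := exists_card_neighbours_le d b hr0
  set S : ℝ := (b + R) / 2 with hS
  set κ : ℝ := 2 * (b / r + 1) with hκ
  have hκ0 : 0 ≤ κ := by positivity
  set V := (volume (Metric.ball (0 : Space d) 1)).toReal with hV
  have hV0 : 0 < V := ENNReal.toReal_pos (Metric.measure_ball_pos volume _ one_pos).ne'
    measure_ball_lt_top.ne
  have hVE : volume (Metric.ball (0 : Space d) 1) = ENNReal.ofReal V :=
    (ENNReal.ofReal_toReal measure_ball_lt_top.ne).symm
  -- At scale η = β^(-1/α) the Hölder error δ = C(κη)^α makes βδ constant, while the volume η^d per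
  -- particle costs only (d/α) log β.
  have hη0 : Tendsto (fun β : ℝ => β ^ (-(1 / (α : ℝ)))) atTop (𝓝 0) :=
    tendsto_rpow_neg_atTop (by positivity)
  have hη1 : ∀ᶠ β : ℝ in atTop, 4 * β ^ (-(1 / (α : ℝ))) < r := by
    have := hη0.const_mul 4
    rw [mul_zero] at this
    exact this.eventually (gt_mem_nhds hr0)
  have hη2 : ∀ᶠ β : ℝ in atTop, S + 2 * β ^ (-(1 / (α : ℝ))) * (S / r + 1) < R := by
    have := ((hη0.const_mul 2).mul_const (S / r + 1)).const_add S
    rw [mul_zero, zero_mul, add_zero] at this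
    exact this.eventually (gt_mem_nhds (by rw [hS]; linarith))
  refine ⟨N * (C * κ ^ (α : ℝ)) + |Real.log V|, d / α, ?_⟩
  filter_upwards [hη1, hη2, eventually_ge_atTop 1] with β h1 h2 hβ1
  have hβ : 0 < β := by linarith
  set η : ℝ := β ^ (-(1 / (α : ℝ))) with hη
  have hηpos : 0 < η := Real.rpow_pos_of_pos hβ _
  have hηα : η ^ (α : ℝ) = β⁻¹ := by
    rw [hη, ← Real.rpow_mul hβ.le, neg_mul, one_div, inv_mul_cancel₀ hα0.ne', Real.rpow_neg_one]
  have hlogη : Real.log η = -(1 / (α : ℝ)) * Real.log β := Real.log_rpow hβ _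
  set δ : ℝ := C * (κ * η) ^ (α : ℝ) with hδ
  have hδ0 : 0 ≤ δ := by positivity
  have hβδ : β * δ = C * κ ^ (α : ℝ) := by
    rw [hδ, Real.mul_rpow hκ0 hηpos.le, hηα]
    field_simp
  have hδH : ∀ s t : ℝ≥0, (r : ℝ) ≤ s → s ≤ t → (s : ℝ) ≤ b →
      (t : ℝ) ≤ s + 2 * η * (b / r + 1) → (v t).toReal ≤ (v s).toReal + δ := by
    intro s t hs hst _ ht
    have hs' : r ≤ s := by exact_mod_cast hs
    have h := hHol.dist_le (Set.mem_Ici.2 (hs'.trans hst)) (Set.mem_Ici.2 hs')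
    have hd : dist t s ≤ κ * η := by
      rw [NNReal.dist_eq, abs_of_nonneg (sub_nonneg.2 (by exact_mod_cast hst)), hκ]
      linarith
    have h3 : dist (v t).toReal (v s).toReal ≤ δ := by
      refine h.trans ?_
      rw [hδ]
      gcongr
    have := (le_abs_self _).trans h3
    linarith
  -- The error is uniform in k, so k → ∞ can be taken at fixed β.
  have key : ∀ k : ℕ+, β * clusterF d v R β k ≤ β * (groundE d v k / k) +
      (N * (C * κ ^ (α : ℝ)) + |Real.log V| + d / α * Real.log β) := by
    intro k
    obtain ⟨n, rfl⟩ : ∃ n : ℕ, k = n.succPNat := ⟨k.natPred, (PNat.succPNat_natPred k).symm⟩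
    obtain ⟨x, hxG, hxC, hxE⟩ := exists_isCluster_groundState hv o
      (show (b : ℝ) < S by rw [hS]; linarith) n.succPNat (hgs _)
    have hsep := hmin n.succPNat x hxG
    have hxE' : realEnergy v x = groundE d v n.succPNat := by
      rw [energy_eq_coe_realEnergy hv fun i j hij => ?_] at hxE
      · exact_mod_cast hxE
      · exact hr.trans_le (by exact_mod_cast hsep i j hij)
    have h := le_clusterZ_of_perturbation (n := n) hv hβ hηpos h1 (by exact_mod_cast hr) hδ0 h2.le
      hsep hxC (hN _ x hsep) hδH
    change ENNReal.ofReal (Real.exp (-(β * (realEnergy (n := (n.succPNat : ℕ)) v x + _)))) * _ ≤ _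
      at h
    rw [hxE', Measure.addHaar_closedBall _ _ hηpos.le, finrank_euclideanSpace_fin, hVE,
      ← ENNReal.ofReal_mul (by positivity), ← ENNReal.ofReal_pow (by positivity),
      ← ENNReal.ofReal_mul (Real.exp_pos _).le,
      ← Real.exp_log (show 0 < (η ^ d * V) ^ n by positivity), ← Real.exp_add] at h
    have h' := clusterF_le_of_le_clusterZ hv o hβ h
    rw [Real.log_pow, Real.log_mul (by positivity) hV0.ne', Real.log_pow, hlogη] at h'
    have hk : ((n.succPNat : ℕ) : ℝ) = n + 1 := by simp
    have hk0 : (0 : ℝ) < (n : ℝ) + 1 := by positivity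
    rw [hk] at h' ⊢
    have hlog : 0 ≤ Real.log β := Real.log_nonneg hβ1
    have hq : 0 ≤ (d : ℝ) / α * Real.log β := by positivity
    have hn0 : (0 : ℝ) ≤ n := Nat.cast_nonneg n
    have h5 : -((n : ℝ) * Real.log V) ≤ (n + 1) * |Real.log V| := by
      have := neg_abs_le (Real.log V)
      have := abs_nonneg (Real.log V)
      nlinarith
    have h6 : (n : ℝ) * (d / α * Real.log β) ≤ (n + 1) * (d / α * Real.log β) := by nlinarith
    have h7 : β * ((n + 1) * (N * δ)) = (n + 1) * (N * (C * κ ^ (α : ℝ))) := by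
      rw [← hβδ]; ring
    have h8 : β * (groundE d v n.succPNat / (n + 1)) +
        (N * (C * κ ^ (α : ℝ)) + |Real.log V| + d / α * Real.log β) =
        (β * groundE d v n.succPNat + (n + 1) *
          (N * (C * κ ^ (α : ℝ)) + |Real.log V| + d / α * Real.log β)) / (n + 1) := by
      field_simp
    rw [h8, le_div_iff₀ hk0]
    have h9 : (n : ℝ) * (d * (-(1 / (α : ℝ)) * Real.log β)) = -(n * (d / α * Real.log β)) := by
      ring
    have h10 : (n : ℝ) * (d * (-(1 / (α : ℝ)) * Real.log β) + Real.log V) =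
      -(n * (d / α * Real.log β)) + n * Real.log V := by rw [← h9]; ring
    rw [h10] at h'
    linarith
  exact le_of_tendsto_of_tendsto' ((tendsto_clusterF hv o hR hβ).const_mul β)
    (((tendsto_groundE_div hv o).1.const_mul β).add_const _) key

end IdealMixture

/-! ### The minimiser of the ideal-mixture rate function -/

namespace IdealMixture

variable {d : ℕ} {v : ℝ≥0 → EReal} {R β ρ : ℝ} {r : ℕ+ → ℝ}

theorem eventually_cofinite_of_atTop {p : ℕ+ → Prop} (h : ∀ᶠ k in atTop, p k) :
    ∀ᶠ k in cofinite, p k := by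
  obtain ⟨K, hK⟩ := eventually_atTop.1 h
  refine (Set.finite_Iio K).subset fun k hk => ?_
  by_contra h'
  exact hk (hK k (not_lt.1 h'))

theorem summable_mul_exp {a : ℝ} (ha : a < 0) :
    Summable fun k : ℕ+ => (k : ℝ) * Real.exp (k * a) := by
  have h := Real.summable_pow_mul_exp_neg_nat_mul 1 (neg_pos.2 ha)
  refine (h.comp_injective PNat.coe_injective).congr fun k => ?_
  simp only [Function.comp_apply, pow_one, neg_neg]
  rw [mul_comm a]

theorem summable_mul_exp_sub {c : ℕ+ → ℝ} (hc : Tendsto c atTop (𝓝 0)) {a : ℝ} (ha : a < 0) :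
    Summable fun k : ℕ+ => (k : ℝ) * Real.exp (k * (a - c k)) := by
  have ha2 : a / 2 < 0 := by linarith
  refine Summable.of_norm_bounded_eventually (summable_mul_exp ha2) ?_
  refine eventually_cofinite_of_atTop ?_
  filter_upwards [hc.eventually (lt_mem_nhds ha2)] with k hk
  rw [Real.norm_of_nonneg (by positivity)]
  gcongr
  linarith

/-- The Lagrange multiplier of the constraint `∑ k ρ_k ≤ ρ`. -/
theorem exists_multiplier {c : ℕ+ → ℝ} (hc : Tendsto c atTop (𝓝 0)) (hρ : 0 < ρ) :
    ∃ a ≤ 0, Admissible ρ (fun k => Real.exp (k * (a - c k))) ∧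
      (a = 0 ∨ ∑' k : ℕ+, (k : ℝ) * Real.exp (k * (a - c k)) = ρ) := by
  have hnn : ∀ (a : ℝ) (k : ℕ+), 0 ≤ (k : ℝ) * Real.exp (k * (a - c k)) := fun a k => by positivity
  -- Finite partial sums are tested because the series may diverge at a = 0. If one of them exceeds
  -- ρ, it still does at some a₁ < 0, where the series converges and depends continuously on the
  -- multiplier.
  by_cases h0 : ∀ s : Finset ℕ+, ∑ k ∈ s, (k : ℝ) * Real.exp (k * (0 - c k)) ≤ ρ
  · exact ⟨0, le_rfl, ⟨fun k => (Real.exp_pos _).le, summable_of_sum_le (hnn 0) h0,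
      Real.tsum_le_of_sum_le (hnn 0) h0⟩, Or.inl rfl⟩
  push Not at h0
  obtain ⟨s, hs⟩ := h0
  let S : ℝ → ℝ := fun a => ∑' k : ℕ+, (k : ℝ) * Real.exp (k * (a - c k))
  have hcont : Continuous fun a : ℝ => ∑ k ∈ s, (k : ℝ) * Real.exp (k * (a - c k)) := by fun_prop
  obtain ⟨a₁, ha₁, hsa₁⟩ : ∃ a₁ < 0, ρ < ∑ k ∈ s, (k : ℝ) * Real.exp (k * (a₁ - c k)) := by
    have h1 : ∀ᶠ a in 𝓝[<] (0 : ℝ), ρ < ∑ k ∈ s, (k : ℝ) * Real.exp (k * (a - c k)) :=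
      (hcont.continuousAt.eventually (lt_mem_nhds hs)).filter_mono nhdsWithin_le_nhds
    obtain ⟨a, ha⟩ := (h1.and self_mem_nhdsWithin).exists
    exact ⟨a, ha.2, ha.1⟩
  have hsum := fun {a : ℝ} (ha : a < 0) => summable_mul_exp_sub hc ha
  have hS₁ : ρ < S a₁ := hsa₁.trans_le ((hsum ha₁).sum_le_tsum s fun k _ => hnn _ k)
  -- Lowering a by t shrinks every term by at least e^(-t) = ρ / S a₁, because k ≥ 1; this gives the
  -- other end for the intermediate value theorem.
  set t := Real.log (S a₁ / ρ) with ht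
  have ht0 : 0 < t := Real.log_pos (by rwa [one_lt_div hρ])
  have hS₂ : S (a₁ - t) ≤ ρ := by
    have h1 : S (a₁ - t) ≤ ∑' k : ℕ+, Real.exp (-t) * ((k : ℝ) * Real.exp (k * (a₁ - c k))) := by
      refine (hsum (by linarith)).tsum_le_tsum (fun k => ?_) ((hsum ha₁).mul_left _)
      rw [mul_left_comm, ← Real.exp_add]
      gcongr
      have : (1 : ℝ) ≤ k := by exact_mod_cast one_le (a := k)
      nlinarith
    rw [tsum_mul_left] at h1
    have h2 : Real.exp (-t) = ρ / S a₁ := by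
      rw [Real.exp_neg, ht, Real.exp_log (div_pos (hρ.trans hS₁) hρ), inv_div]
    rw [h2] at h1
    change _ ≤ ρ / S a₁ * S a₁ at h1
    rwa [div_mul_cancel₀ _ (hρ.trans hS₁).ne'] at h1
  have hScont : ContinuousOn S (Set.Icc (a₁ - t) a₁) := by
    refine continuousOn_tsum (u := fun k : ℕ+ => (k : ℝ) * Real.exp (k * (a₁ - c k)))
      (fun k => by fun_prop) (hsum ha₁) fun k a ha => ?_
    rw [Real.norm_of_nonneg (hnn a k)]
    have := ha.2
    gcongr
  obtain ⟨a, ha, hSa⟩ := intermediate_value_Icc (by linarith) hScont ⟨hS₂, hS₁.le⟩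
  have ha0 : a < 0 := ha.2.trans_lt ha₁
  exact ⟨a, ha0.le, ⟨fun k => (Real.exp_pos _).le, hsum ha0, hSa.le⟩, Or.inr hSa⟩

/-- Young's inequality -t log t ≤ xt + e^(-x) - t controls the singular side near t = 0. Taking x =
k makes the entropy series converge under the mass constraint. -/
theorem abs_mul_log_sub_one_le {t x : ℝ} (ht : 0 ≤ t) (hx : 0 ≤ x) (htρ : t ≤ ρ) :
    |t * (Real.log t - 1)| ≤ (x + ρ + 1) * t + Real.exp (-x) := by
  rcases ht.eq_or_lt with rfl | ht
  · simp [(Real.exp_pos _).le]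
  have h1 : Real.log t ≤ t - 1 := Real.log_le_sub_one_of_pos ht
  have h2 : -x - Real.log t ≤ Real.exp (-x) / t - 1 := by
    have := Real.log_le_sub_one_of_pos (show 0 < Real.exp (-x) / t by positivity)
    rwa [Real.log_div (Real.exp_pos _).ne' ht.ne', Real.log_exp] at this
  have h3 := mul_le_mul_of_nonneg_left h1 ht.le
  have h4 := mul_le_mul_of_nonneg_left h2 ht.le
  have h5 : t * (Real.exp (-x) / t - 1) = Real.exp (-x) - t := by field_simp
  rw [h5] at h4
  have h6 := mul_le_mul_of_nonneg_left htρ ht.le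
  have h7 := Real.exp_pos (-x)
  have h8 : 0 ≤ x * t := by positivity
  have h9 : 0 ≤ ρ * t := by nlinarith
  rw [abs_le]
  constructor <;> nlinarith

theorem Admissible.le (h : Admissible ρ r) (k : ℕ+) : (k : ℝ) * r k ≤ ρ :=
  (h.2.1.le_tsum k fun j _ => mul_nonneg (by positivity) (h.1 j)).trans h.2.2

theorem Admissible.summable_entropy (h : Admissible ρ r) :
    Summable fun k : ℕ+ => r k * (Real.log (r k) - 1) := by
  have hρ : 0 ≤ ρ := (mul_nonneg (by positivity) (h.1 1)).trans (h.le 1)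
  have hexp : Summable fun k : ℕ+ => Real.exp (-(k : ℝ)) := by
    refine Summable.of_nonneg_of_le (fun k => (Real.exp_pos _).le) (fun k => ?_)
      (summable_mul_exp (show (-1 : ℝ) < 0 by norm_num))
    have : (1 : ℝ) ≤ k := by exact_mod_cast one_le (a := k)
    rw [mul_neg_one]
    exact le_mul_of_one_le_left (Real.exp_pos _).le this
  refine Summable.of_norm_bounded ((h.2.1.mul_left (1 + ρ + 1)).add hexp) fun k => ?_
  have hk : (1 : ℝ) ≤ k := by exact_mod_cast one_le (a := k)
  have hr := h.1 k
  have hle : r k ≤ (k : ℝ) * r k := le_mul_of_one_le_left hr hk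
  refine (abs_mul_log_sub_one_le hr (by positivity : (0 : ℝ) ≤ k) (hle.trans (h.le k))).trans ?_
  have : ρ * r k ≤ ρ * (k * r k) := mul_le_mul_of_nonneg_left hle hρ
  linarith

theorem Admissible.summable_energy {F : ℕ+ → ℝ} {f : ℝ} (hF : Tendsto F atTop (𝓝 f))
    (h : Admissible ρ r) : Summable fun k : ℕ+ => (k : ℝ) * r k * F k := by
  refine Summable.of_norm_bounded_eventually (h.2.1.mul_right (|f| + 1))
    (eventually_cofinite_of_atTop ?_)
  filter_upwards [hF.abs.eventually (gt_mem_nhds (lt_add_one |f|))] with k hk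
  have := h.1 k
  rw [norm_mul, Real.norm_of_nonneg (by positivity : (0 : ℝ) ≤ k * r k), Real.norm_eq_abs]
  gcongr

/-- Tangent-line inequality for the convex function t(log t - 1), whose derivative at r is log r; it
includes s = 0, where `Real.log 0 = 0`. -/
theorem mul_log_add_le {s r : ℝ} (hs : 0 ≤ s) (hr : 0 < r) :
    r * (Real.log r - 1) + (s - r) * Real.log r ≤ s * (Real.log s - 1) := by
  rcases hs.eq_or_lt with rfl | hs
  · simp; linarith
  have h := Real.log_le_sub_one_of_pos (show 0 < r / s by positivity)
  rw [Real.log_div hr.ne' hs.ne'] at h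
  have h2 := mul_le_mul_of_nonneg_left h hs.le
  have h3 : s * (r / s - 1) = r - s := by field_simp
  rw [h3] at h2
  linarith

theorem mul_log_add_lt {s r : ℝ} (hs : 0 ≤ s) (hr : 0 < r) (hne : s ≠ r) :
    r * (Real.log r - 1) + (s - r) * Real.log r < s * (Real.log s - 1) := by
  rcases hs.eq_or_lt with rfl | hs
  · simp; linarith
  have h := Real.log_lt_sub_one_of_pos (show 0 < r / s by positivity)
    (by rw [ne_eq, div_eq_one_iff_eq hs.ne']; exact hne.symm)
  rw [Real.log_div hr.ne' hs.ne'] at h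
  have h2 := mul_lt_mul_of_pos_left h hs
  have h3 : s * (r / s - 1) = r - s := by field_simp
  rw [h3] at h2
  linarith

/-- Merging the three series into one permits termwise comparison of two sequences. -/
theorem idealF_eq_tsum (hβ : 0 < β) {r : ℕ+ → ℝ}
    (hF : Tendsto (clusterF d v R β) atTop (𝓝 (clusterFInf d v R β))) (h : Admissible ρ r) :
    idealF d v R β ρ r = ρ * clusterFInf d v R β + 1 / β * ∑' k : ℕ+,
      ((k : ℝ) * r k * (β * (clusterF d v R β k - clusterFInf d v R β)) +
        r k * (Real.log (r k) - 1)) := by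
  have h1 := h.summable_energy hF
  have h2 := h.2.1.mul_right (clusterFInf d v R β)
  rw [idealF, Summable.tsum_add _ h.summable_entropy]
  · have : ∀ k : ℕ+, (k : ℝ) * r k * (β * (clusterF d v R β k - clusterFInf d v R β)) =
        β * ((k : ℝ) * r k * clusterF d v R β k - (k : ℝ) * r k * clusterFInf d v R β) :=
      fun k => by ring
    simp only [this]
    rw [tsum_mul_left, h1.tsum_sub h2, tsum_mul_right]
    field_simp
    ring
  · refine ((h1.sub h2).mul_left β).congr fun k => ?_
    ring

/-- The minimiser of the ideal-mixture rate function, with its Lagrange multiplier. -/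
theorem exists_isIdealMinimiser (hβ : 0 < β) (hρ : 0 < ρ)
    (hF : Tendsto (clusterF d v R β) atTop (𝓝 (clusterFInf d v R β))) :
    ∃ a ≤ 0, ∃ r : ℕ+ → ℝ, IsIdealMinimiser d v R β ρ r ∧
      (∀ s, IsIdealMinimiser d v R β ρ s → s = r) ∧
      (∀ k : ℕ+, r k = Real.exp (k * (a - β * (clusterF d v R β k - clusterFInf d v R β)))) ∧
      (a = 0 ∨ ∑' k : ℕ+, (k : ℝ) * r k = ρ) := by
  have hc : Tendsto (fun k => β * (clusterF d v R β k - clusterFInf d v R β)) atTop (𝓝 0) := by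
    have := (hF.sub_const (clusterFInf d v R β)).const_mul β
    rwa [sub_self, mul_zero] at this
  obtain ⟨a, ha, hr, har⟩ := exists_multiplier hc hρ
  set c : ℕ+ → ℝ := fun k => β * (clusterF d v R β k - clusterFInf d v R β) with hcdef
  set r : ℕ+ → ℝ := fun k => Real.exp (k * (a - c k)) with hrdef
  have hsum : ∀ s : ℕ+ → ℝ, Admissible ρ s →
      Summable fun k : ℕ+ => (k : ℝ) * s k * c k + s k * (Real.log (s k) - 1) := fun s hs =>
    (hs.summable_energy hc).add hs.summable_entropy
  have hlog : ∀ k, Real.log (r k) = k * (a - c k) := fun k => Real.log_exp _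
  have hrpos : ∀ k, 0 < r k := fun k => Real.exp_pos _
  -- Complementary slackness: either a = 0, or r has the full mass ρ and a ≤ 0.
  have hlin : ∀ s, Admissible ρ s → 0 ≤ ∑' k : ℕ+, (a * (k * s k) - a * (k * r k)) := by
    intro s hs
    rw [(hs.2.1.mul_left a).tsum_sub (hr.2.1.mul_left a), tsum_mul_left, tsum_mul_left, ← mul_sub]
    rcases har with h | h
    · simp [h]
    · refine mul_nonneg_of_nonpos_of_nonpos ha ?_
      change ∑' k : ℕ+, (k : ℝ) * r k = ρ at h
      rw [h]
      linarith [hs.2.2]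
  have hlinS : ∀ s, Admissible ρ s → Summable fun k : ℕ+ => a * (k * s k) - a * (k * r k) :=
    fun s hs => (hs.2.1.mul_left a).sub (hr.2.1.mul_left a)
  have hlt : ∀ s, Admissible ρ s → s ≠ r → idealF d v R β ρ r < idealF d v R β ρ s := by
    intro s hs hne
    obtain ⟨j, hj⟩ := Function.ne_iff.1 hne
    rw [idealF_eq_tsum hβ hF hr, idealF_eq_tsum hβ hF hs]
    have hkey : ∑' k : ℕ+, ((k : ℝ) * r k * c k + r k * (Real.log (r k) - 1)) <
        ∑' k : ℕ+, ((k : ℝ) * s k * c k + s k * (Real.log (s k) - 1)) := by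
      -- The slackness terms turn the comparison into the tangent-line inequality for each k, since
      -- log r_k = k(a - c_k). It is strict at an index where s and r differ.
      have h1 : ∑' k : ℕ+, (((k : ℝ) * r k * c k + r k * (Real.log (r k) - 1)) +
          (a * (k * s k) - a * (k * r k))) <
          ∑' k : ℕ+, ((k : ℝ) * s k * c k + s k * (Real.log (s k) - 1)) := by
        refine Summable.tsum_lt_tsum (i := j) (fun k => ?_) ?_
          ((hsum r hr).add (hlinS s hs)) (hsum s hs)
        · have := mul_log_add_le (hs.1 k) (hrpos k)
          rw [hlog] at this ⊢
          linarith
        · have := mul_log_add_lt (hs.1 j) (hrpos j) hj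
          rw [hlog] at this ⊢
          linarith
      rw [(hsum r hr).tsum_add (hlinS s hs)] at h1
      linarith [hlin s hs]
    have := mul_lt_mul_of_pos_left hkey (one_div_pos.2 hβ)
    exact add_lt_add_right this _
  have hmin : IsIdealMinimiser d v R β ρ r := by
    refine ⟨hr, fun s hs => ?_⟩
    by_cases h : s = r
    · rw [h]
    · exact (hlt s hs h).le
  refine ⟨a, ha, r, hmin, fun s hs => ?_, fun k => rfl, har⟩
  by_contra hne
  exact absurd (hs.2 r hr) (not_le.2 (hlt s hs.1 hne))

theorem exists_idealMinimiser_eq (hβ : 0 < β) (hρ : 0 < ρ)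
    (hF : Tendsto (clusterF d v R β) atTop (𝓝 (clusterFInf d v R β))) :
    Admissible ρ (idealMinimiser d v R β ρ) ∧ ∃ a ≤ 0,
      (∀ k : ℕ+, idealMinimiser d v R β ρ k =
        Real.exp (k * (a - β * (clusterF d v R β k - clusterFInf d v R β)))) ∧
      (a = 0 ∨ ∑' k : ℕ+, (k : ℝ) * idealMinimiser d v R β ρ k = ρ) := by
  obtain ⟨a, ha, r, hr, huniq, hval, har⟩ := exists_isIdealMinimiser hβ hρ hF
  have h : IsIdealMinimiser d v R β ρ (idealMinimiser d v R β ρ) :=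
    Classical.epsilon_spec (p := IsIdealMinimiser d v R β ρ) ⟨r, hr⟩
  rw [huniq _ h]
  exact ⟨hr.1, a, ha, hval, har⟩

end IdealMixture

/-! ### Asymptotics of the cluster size distribution -/

namespace IdealMixture

variable {d : ℕ} {v : ℝ≥0 → EReal} {rhc b : ℝ≥0} {R ν : ℝ}

theorem exists_forall_le_of_tendsto {f : ℕ+ → ℝ} {e : ℝ} (hf : Tendsto f atTop (𝓝 e)) {k₁ : ℕ+}
    (hk₁ : f k₁ < e) : ∃ k, ∀ j, f k ≤ f j := by
  have hfin : {j | f j ≤ f k₁}.Finite := by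
    have := eventually_cofinite_of_atTop (hf.eventually (lt_mem_nhds hk₁))
    simpa [eventually_cofinite] using this
  obtain ⟨k, hk, hmin⟩ := Set.exists_min_image _ f hfin ⟨k₁, le_refl (f k₁)⟩
  refine ⟨k, fun j => ?_⟩
  rcases le_total (f j) (f k₁) with h | h
  · exact hmin j h
  · exact le_trans hk h

theorem exists_pos_forall_add_le {f : ℕ+ → ℝ} {e m : ℝ} (hf : Tendsto f atTop (𝓝 e)) (hm : m < e)
    {k : ℕ+} (h : ∀ j, j ≠ k → m < f j) : ∃ δ > 0, ∀ j, j ≠ k → m + δ ≤ f j := by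
  -- Overwriting the excluded value by the limit e keeps the limit and removes the minimal value m.
  let g : ℕ+ → ℝ := Function.update f k e
  have hg : Tendsto g atTop (𝓝 e) := by
    refine hf.congr' ?_
    filter_upwards [eventually_gt_atTop k] with j hj
    exact (Function.update_of_ne hj.ne' _ _).symm
  have hgj : ∀ j, j ≠ k → g j = f j := fun j hj => Function.update_of_ne hj _ _
  have hgm : ∀ j, m < g j := by
    intro j
    by_cases hj : j = k
    · simpa [hj, g] using hm
    · rw [hgj j hj]; exact h j hj
  by_cases hall : ∀ j, e ≤ g j
  · refine ⟨e - m, by linarith, fun j hj => ?_⟩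
    have := hall j
    rw [hgj j hj] at this
    linarith
  · push Not at hall
    obtain ⟨j₁, hj₁⟩ := hall
    obtain ⟨i, hi⟩ := exists_forall_le_of_tendsto hg hj₁
    refine ⟨g i - m, by linarith [hgm i], fun j hj => ?_⟩
    have := hi j
    rw [hgj j hj] at this
    linarith

theorem eq_zero_of_eventually_mul_nonneg {s x : ℝ} (h : ∀ᶠ t in 𝓝 x, 0 ≤ s * (t - x)) :
    s = 0 := by
  obtain ⟨ε, hε, hball⟩ := Metric.eventually_nhds_iff.1 h
  have h1 := hball (y := x + ε / 2) (by rw [Real.dist_eq, abs_lt]; constructor <;> linarith)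
  have h2 := hball (y := x - ε / 2) (by rw [Real.dist_eq, abs_lt]; constructor <;> linarith)
  have h1' : 0 ≤ s * (ε / 2) := by simpa using h1
  have h2' : 0 ≤ s * (-(ε / 2)) := by simpa using h2
  nlinarith

theorem bddBelow_range_line (hv : PairPotential d v rhc b) (o : Fin d) (ν : ℝ) :
    BddBelow (Set.range fun k : ℕ+ => (groundE d v k - ν) / k) := by
  obtain ⟨B, hB⟩ := exists_le_groundE hv o
  refine ⟨-B - |ν|, ?_⟩
  rintro _ ⟨k, rfl⟩
  have hk : (1 : ℝ) ≤ k := by exact_mod_cast one_le (a := k)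
  simp only
  rw [le_div_iff₀ (by linarith)]
  have h1 := hB k
  have h2 := le_abs_self ν
  have h3 := le_mul_of_one_le_right (abs_nonneg ν) hk
  linarith

theorem muNu_le (hv : PairPotential d v rhc b) (o : Fin d) (ν : ℝ) (k : ℕ+) :
    muNu d v ν ≤ (groundE d v k - ν) / k :=
  ciInf_le (bddBelow_range_line hv o ν) k

theorem nuStar_le (hv : PairPotential d v rhc b) (o : Fin d) (k : ℕ+) :
    nuStar d v ≤ groundE d v k - k * groundEInf d v := by
  refine ciInf_le ⟨0, ?_⟩ k
  rintro _ ⟨j, rfl⟩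
  have := (tendsto_groundE_div hv o).2 j
  simp only
  linarith

theorem tendsto_line (hv : PairPotential d v rhc b) (o : Fin d) (ν : ℝ) :
    Tendsto (fun k : ℕ+ => (groundE d v k - ν) / k) atTop (𝓝 (groundEInf d v)) := by
  have h1 : Tendsto (fun k : ℕ+ => ν / (k : ℝ)) atTop (𝓝 0) :=
    (tendsto_const_div_atTop_nhds_zero_nat ν).comp tendsto_PNat_val_atTop_atTop
  have h2 := (tendsto_groundE_div hv o).1.sub h1
  rw [sub_zero] at h2
  exact h2.congr fun k => (sub_div _ _ _).symm

/-- Off the kinks μ is affine near ν, and a line lying above it and touching it at ν has the same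
slope; the slope -1/k determines k. -/
theorem muNu_eq_line_unique (hv : PairPotential d v rhc b) (o : Fin d)
    (hν : nuStar d v ≤ ν) (hk : ν ∉ kinks d v) {j k : ℕ+}
    (hj : muNu d v ν = (groundE d v j - ν) / j) (hk' : muNu d v ν = (groundE d v k - ν) / k) :
    j = k := by
  obtain ⟨a, c, hac⟩ : ∃ a c : ℝ, ∀ᶠ t in 𝓝 ν, muNu d v t = a * t + c := by
    by_contra h
    exact hk ⟨hν, h⟩
  have slope : ∀ i : ℕ+, muNu d v ν = (groundE d v i - ν) / i → -(1 / (i : ℝ)) - a = 0 := by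
    intro i hi
    refine eq_zero_of_eventually_mul_nonneg (x := ν) ?_
    have h0 := hac.self_of_nhds
    filter_upwards [hac] with t ht
    have h1 := muNu_le hv o t i
    rw [ht] at h1
    rw [h0] at hi
    have h2 : (groundE d v i - t) / i = (groundE d v i - ν) / i - (t - ν) * (1 / i) := by ring
    rw [h2] at h1
    linarith
  have h1 := slope j hj
  have h2 := slope k hk'
  have h3 : (1 : ℝ) / j = 1 / k := by linarith
  rw [one_div, one_div, inv_inj] at h3
  exact_mod_cast h3

/-- ν > ν* means that some line lies below e_∞ at ν, while the lines converge to e_∞ as k → ∞. Only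
finitely many compete, so the infimum is attained, and the other lines stay away from it. -/
theorem exists_muNu_eq_line (hv : PairPotential d v rhc b) (o : Fin d)
    (hν : nuStar d v < ν) (hk : ν ∉ kinks d v) :
    muNu d v ν < groundEInf d v ∧
    ∃ k : ℕ+, (∀ j : ℕ+, muNu d v ν = (groundE d v j - ν) / j ↔ j = k) ∧ 0 < gap d v ν k ∧
      ∀ j : ℕ+, j ≠ k → gap d v ν k ≤ (groundE d v j - ν) / j - muNu d v ν := by
  obtain ⟨k₁, hk₁⟩ := exists_lt_of_ciInf_lt hν
  have hk₁' : (groundE d v k₁ - ν) / k₁ < groundEInf d v := by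
    rw [div_lt_iff₀ (by exact_mod_cast k₁.pos)]
    linarith
  have hlt := (muNu_le hv o ν k₁).trans_lt hk₁'
  obtain ⟨k, hmin⟩ := exists_forall_le_of_tendsto (tendsto_line hv o ν) hk₁'
  have hmu : muNu d v ν = (groundE d v k - ν) / k :=
    le_antisymm (muNu_le hv o ν k) (le_ciInf hmin)
  have huniq : ∀ j : ℕ+, muNu d v ν = (groundE d v j - ν) / j → j = k := fun j hj =>
    muNu_eq_line_unique hv o hν.le hk hj hmu
  obtain ⟨δ, hδ, hδle⟩ := exists_pos_forall_add_le (tendsto_line hv o ν) hlt (k := k)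
    fun j hj => lt_of_le_of_ne (muNu_le hv o ν j) fun h => hj (huniq j h)
  have : Nonempty {j : ℕ+ // j ≠ k} := ⟨⟨k + 1, (PNat.lt_add_right k 1).ne'⟩⟩
  refine ⟨hlt, k, fun j => ⟨huniq j, fun h => h ▸ hmu⟩, ?_, fun j hj => ?_⟩
  · refine lt_of_lt_of_le hδ (le_ciInf fun j => ?_)
    linarith [hδle j.1 j.2]
  · refine ciInf_le (f := fun j : {j : ℕ+ // j ≠ k} =>
      (groundE d v j.1 - ν) / j.1 - muNu d v ν) ⟨0, ?_⟩ ⟨j, hj⟩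
    rintro _ ⟨i, rfl⟩
    exact sub_nonneg.2 (muNu_le hv o ν i.1)

/-- For θ ≤ -1 and k ≥ 1, kθ ≤ (θ + 1) - k, so the first term sets the decay rate. -/
theorem tsum_mul_exp_le {θ : ℝ} (hθ : θ ≤ -1) :
    ∑' k : ℕ+, (k : ℝ) * Real.exp (k * θ) ≤
      Real.exp (θ + 1) * ∑' k : ℕ+, (k : ℝ) * Real.exp (k * (-1)) := by
  rw [← tsum_mul_left]
  refine (summable_mul_exp (by linarith)).tsum_le_tsum (fun k => ?_)
    ((summable_mul_exp (by norm_num)).mul_left _)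
  rw [mul_left_comm, ← Real.exp_add]
  gcongr
  have hk : (1 : ℝ) ≤ k := by exact_mod_cast one_le (a := k)
  nlinarith

/-- With q = βf_∞ + a, the minimiser is r_j = exp(jq - βj f_j). The single bound r_k ≤ ρ forces q ≤
β(μ(ν) + ε) < βf_∞, so a ≠ 0 and the mass is saturated. The deficit of size k is therefore the mass
of all other sizes, which the gap makes small. -/
theorem isBigO_supersaturated (hv : PairPotential d v rhc b) (o : Fin d) (hR : (b : ℝ) < R)
    (hlt : muNu d v ν < groundEInf d v) {k : ℕ+}
    (hk : muNu d v ν = (groundE d v k - ν) / k) (hgap : 0 < gap d v ν k)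
    (hgaple : ∀ j : ℕ+, j ≠ k → gap d v ν k ≤ (groundE d v j - ν) / j - muNu d v ν) :
    (fun β : ℝ => k * idealMinimiser d v R β (Real.exp (-(β * ν))) k / Real.exp (-(β * ν)) - 1)
      =O[atTop] fun β : ℝ => Real.exp (-(β * gap d v ν k / 2)) := by
  set Δ := gap d v ν k with hΔ
  set m := muNu d v ν with hm
  set e := groundEInf d v with he
  obtain ⟨M, hM⟩ := exists_le_clusterF hv o hR
  -- The first bound leaves a gap 3Δ/4 in the exponent; the second keeps q strictly below βf_∞ for
  -- large β.
  let ε : ℝ := min (Δ / 4) ((e - m) / 2)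
  have hε : 0 < ε := lt_min (by linarith) (by linarith)
  have hε1 : ε ≤ Δ / 4 := min_le_left _ _
  have hε2 : ε ≤ (e - m) / 2 := min_le_right _ _
  let T : ℝ := ∑' k : ℕ+, (k : ℝ) * Real.exp (k * (-1))
  have hT : 0 ≤ T := tsum_nonneg fun k => by positivity
  refine IsBigO.of_bound (Real.exp (M + 1) * T) ?_
  filter_upwards [eventually_gt_atTop 0, eventually_clusterF_le hv o hR k hε,
    eventually_gt_atTop (M / ((e - m) / 2)), eventually_ge_atTop ((M + 1) / (3 * Δ / 4))]
    with β hβ hf hβ1 hβ2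
  rw [div_lt_iff₀ (by linarith)] at hβ1
  rw [div_le_iff₀ (by linarith)] at hβ2
  set ρ := Real.exp (-(β * ν)) with hρ
  have hρ0 : 0 < ρ := Real.exp_pos _
  have hF := tendsto_clusterF hv o hR hβ
  obtain ⟨hadm, a, ha, hval, har⟩ := exists_idealMinimiser_eq hβ hρ0 hF
  set r := idealMinimiser d v R β ρ with hr
  set q := β * clusterFInf d v R β + a with hq
  have hval' : ∀ j : ℕ+, r j = Real.exp (j * q - β * j * clusterF d v R β j) := by
    intro j
    rw [hval]
    congr 1
    rw [hq]
    ring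
  have hk1 : (1 : ℝ) ≤ k := by exact_mod_cast one_le (a := k)
  have hk0 : (0 : ℝ) < k := by linarith
  have hqle : q ≤ β * (m + ε) := by
    have h1 : r k ≤ ρ := (le_mul_of_one_le_left (hadm.1 k) hk1).trans (hadm.le k)
    rw [hval', hρ, Real.exp_le_exp] at h1
    have h2 : β * k * clusterF d v R β k ≤ β * k * (groundE d v k / k + ε) :=
      mul_le_mul_of_nonneg_left hf (by positivity)
    have h3 : β * k * (groundE d v k / k + ε) = k * (β * (m + ε)) + β * ν := by
      rw [hk]; field_simp; ring
    refine le_of_mul_le_mul_left ?_ hk0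
    linarith
  have hsat : ∑' j : ℕ+, (j : ℝ) * r j = ρ := by
    refine har.resolve_left fun ha0 => ?_
    have h1 : β * e - M ≤ β * clusterFInf d v R β := by
      refine le_of_tendsto_of_tendsto' (((tendsto_groundE_div hv o).1.const_mul β).sub_const M)
        (hF.const_mul β) fun j => ?_
      have hj : (0 : ℝ) < j := by exact_mod_cast j.pos
      have h2 := hM β hβ j
      have h3 : β * (groundE d v j / j) - M = (β * groundE d v j - M * j) / j := by field_simp
      rw [h3, div_le_iff₀ hj]
      linarith
    rw [ha0, add_zero] at hq
    rw [hq] at hqle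
    have h4 := mul_le_mul_of_nonneg_left hε2 hβ.le
    linarith
  let θ : ℝ := M - β * (3 * Δ / 4)
  have hθ : θ ≤ -1 := by simp only [θ]; linarith
  have hbound : ∀ j : ℕ+, j ≠ k → (j : ℝ) * r j ≤ ρ * ((j : ℝ) * Real.exp (j * θ)) := by
    intro j hj
    have hj0 : (0 : ℝ) < j := by exact_mod_cast j.pos
    rw [hval', mul_left_comm, hρ, ← Real.exp_add]
    gcongr
    have h1 := hM β hβ j
    have h2 := hgaple j hj
    have h3 : Δ * j ≤ groundE d v j - ν - m * j := by
      have h4 := mul_le_mul_of_nonneg_right h2 hj0.le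
      have h5 : ((groundE d v j - ν) / j - m) * j = groundE d v j - ν - m * j := by field_simp
      linarith
    have h4 := mul_le_mul_of_nonneg_left h3 hβ.le
    have h5 := mul_le_mul_of_nonneg_left hqle hj0.le
    have h6 := mul_le_mul_of_nonneg_left hε1 (by positivity : 0 ≤ (j : ℝ) * β)
    simp only [θ]
    linarith
  have hS := summable_mul_exp (show θ < 0 by linarith)
  have hsplit := hadm.2.1.tsum_eq_add_tsum_ite k
  rw [hsat] at hsplit
  have hrest : ∑' j : ℕ+, (if j = k then 0 else (j : ℝ) * r j) ≤
      ρ * (Real.exp (θ + 1) * T) := by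
    have h1 : ∑' j : ℕ+, (if j = k then 0 else (j : ℝ) * r j) ≤
        ∑' j : ℕ+, ρ * ((j : ℝ) * Real.exp (j * θ)) := by
      have hle : ∀ j : ℕ+, (if j = k then 0 else (j : ℝ) * r j) ≤
          ρ * ((j : ℝ) * Real.exp (j * θ)) := by
        intro j
        split_ifs with hj
        · positivity
        · exact hbound j hj
      refine Summable.tsum_le_tsum hle ?_ (hS.mul_left ρ)
      refine Summable.of_nonneg_of_le (fun j => ?_) hle (hS.mul_left ρ)
      split_ifs
      · exact le_rfl
      · exact mul_nonneg (by positivity) (hadm.1 j)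
    rw [tsum_mul_left] at h1
    exact h1.trans (mul_le_mul_of_nonneg_left (tsum_mul_exp_le hθ) hρ0.le)
  have hle1 : (k : ℝ) * r k / ρ ≤ 1 := (div_le_one hρ0).2 (hadm.le k)
  rw [Real.norm_eq_abs, abs_of_nonpos (by linarith), Real.norm_of_nonneg (Real.exp_pos _).le]
  have h7 : -((k : ℝ) * r k / ρ - 1) =
      (∑' j : ℕ+, (if j = k then 0 else (j : ℝ) * r j)) / ρ := by
    rw [eq_div_iff hρ0.ne']
    field_simp
    linarith
  rw [h7, div_le_iff₀ hρ0]
  refine hrest.trans ?_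
  have h8 : Real.exp (θ + 1) ≤ Real.exp (M + 1) * Real.exp (-(β * Δ / 2)) := by
    rw [← Real.exp_add, Real.exp_le_exp]
    simp only [θ]
    have : 0 < β * Δ := by positivity
    linarith
  calc ρ * (Real.exp (θ + 1) * T)
      ≤ ρ * (Real.exp (M + 1) * Real.exp (-(β * Δ / 2)) * T) := by gcongr
    _ = _ := by ring

/-- The bound e^y ≥ y^6/6! at y = c√k leaves a multiple of k^(-2); 720 is 6!. -/
theorem summable_mul_exp_neg_sqrt {c : ℝ} (hc : 0 < c) :
    Summable fun k : ℕ+ => (k : ℝ) * Real.exp (-(c * Real.sqrt k)) := by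
  have h : Summable fun k : ℕ+ => (720 / c ^ 6) * (1 / (k : ℝ) ^ 2) :=
    ((Real.summable_one_div_nat_pow.2 one_lt_two).comp_injective PNat.coe_injective).mul_left _
  refine Summable.of_nonneg_of_le (fun k => by positivity) (fun k => ?_) h
  have hk : (0 : ℝ) < k := by exact_mod_cast k.pos
  have h1 := Real.pow_div_factorial_le_exp (c * Real.sqrt k) (by positivity) 6
  have h2 : (c * Real.sqrt k) ^ 6 = c ^ 6 * (k : ℝ) ^ 3 := by
    rw [mul_pow, show Real.sqrt k ^ 6 = (Real.sqrt k ^ 2) ^ 3 by ring, Real.sq_sqrt hk.le]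
  rw [h2, show ((6 ! : ℕ) : ℝ) = 720 by norm_num [Nat.factorial]] at h1
  rw [Real.exp_neg, ← div_eq_mul_inv, div_le_iff₀ (Real.exp_pos _)]
  calc (k : ℝ) = 720 / c ^ 6 * (1 / (k : ℝ) ^ 2) * (c ^ 6 * (k : ℝ) ^ 3 / 720) := by field_simp
    _ ≤ _ := by gcongr

theorem isBigO_gas (hv : PairPotential d v rhc b) (o : Fin d) (hd : 2 ≤ d) (hR : (b : ℝ) < R)
    (hH : HolderHypothesis d v rhc) (hS : SurfaceHypothesis d v R)
    (hgs : ∀ k : ℕ+, ∃ x : Fin k → Space d, IsGroundState v x) (ν : ℝ) :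
    ∃ g : ℝ → ℝ, g =O[atTop] Real.log ∧
      (fun β : ℝ => ∑' k : ℕ+,
          k * idealMinimiser d v R β (Real.exp (-(β * ν))) k / Real.exp (-(β * ν)))
        =O[atTop] fun β : ℝ => Real.exp (-(β * (nuStar d v - ν)) + g β) := by
  obtain ⟨C, hC, hS⟩ := hS
  obtain ⟨M, hM⟩ := exists_le_clusterF hv o hR
  obtain ⟨D, a, hDa⟩ := exists_clusterFInf_le hv o hR hH hgs
  -- Beyond K, half of the surface term C√k already exceeds ν*; the other half provides summability.
  obtain ⟨K, hK⟩ := exists_nat_ge ((2 * |nuStar d v| / C) ^ 2)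
  have hK' : nuStar d v ≤ C * Real.sqrt K / 2 := by
    have h1 := Real.le_sqrt_of_sq_le hK
    rw [div_le_iff₀ hC] at h1
    linarith [le_abs_self (nuStar d v)]
  -- The term with √K lets sizes k ≤ K, which do not use the surface bound, carry the same factor
  -- exp(-(C/2)√k) as the others.
  let Q : ℝ := Real.exp (K * (|M| + |D|) + C / 2 * Real.sqrt K)
  let T : ℝ := ∑' k : ℕ+, (k : ℝ) * Real.exp (-(C / 2 * Real.sqrt k))
  have hsum := summable_mul_exp_neg_sqrt (half_pos hC)
  refine ⟨fun β => K * |a| * Real.log β, (isBigO_refl _ _).const_mul_left _,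
    IsBigO.of_bound (Q * T) ?_⟩
  filter_upwards [hS, hDa, eventually_ge_atTop 1] with β hβS hβD hβ1
  have hβ : 0 < β := by linarith
  have hlog : 0 ≤ Real.log β := Real.log_nonneg hβ1
  set ρ := Real.exp (-(β * ν)) with hρ
  have hρ0 : 0 < ρ := Real.exp_pos _
  obtain ⟨hadm, l, hl, hval, -⟩ :=
    exists_idealMinimiser_eq hβ hρ0 (tendsto_clusterF hv o hR hβ)
  set r := idealMinimiser d v R β ρ with hr
  set s := nuStar d v with hs
  have hrle : ∀ k : ℕ+, r k ≤
      Real.exp (-(β * (k * clusterF d v R β k - k * clusterFInf d v R β))) := by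
    intro k
    rw [hval, Real.exp_le_exp]
    have hk : (0 : ℝ) < k := by exact_mod_cast k.pos
    have := mul_nonpos_of_nonneg_of_nonpos hk.le hl
    linarith
  have hterm : ∀ k : ℕ+, r k ≤
      Real.exp (-(β * s) + K * |a| * Real.log β) * (Q * Real.exp (-(C / 2 * Real.sqrt k))) := by
    intro k
    have hk1 : (1 : ℝ) ≤ k := by exact_mod_cast one_le (a := k)
    refine (hrle k).trans ?_
    simp only [Q]
    rw [← Real.exp_add, ← Real.exp_add, Real.exp_le_exp]
    rcases le_or_gt (k : ℕ) K with hkK | hkK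
    · have hkK' : (k : ℝ) ≤ K := by exact_mod_cast hkK
      have h1 := hM β hβ k
      have h2 := mul_le_mul_of_nonneg_left (nuStar_le hv o k) hβ.le
      have h3 := mul_le_mul_of_nonneg_left hβD (by linarith : (0 : ℝ) ≤ k)
      have h4 : (k : ℝ) * (M + D + a * Real.log β) ≤ K * (|M| + |D| + |a| * Real.log β) := by
        have h5 : M + D + a * Real.log β ≤ |M| + |D| + |a| * Real.log β :=
          add_le_add (add_le_add (le_abs_self M) (le_abs_self D))
            (mul_le_mul_of_nonneg_right (le_abs_self a) hlog)
        exact (mul_le_mul_of_nonneg_left h5 (by linarith)).trans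
          (mul_le_mul_of_nonneg_right hkK' (by positivity))
      have h6 : C / 2 * Real.sqrt k ≤ C / 2 * Real.sqrt K := by gcongr
      linarith
    · have hkK' : (K : ℝ) ≤ k := by exact_mod_cast hkK.le
      have h1 : C * Real.sqrt k ≤ k * clusterF d v R β k - k * clusterFInf d v R β := by
        refine le_trans ?_ (hβS k)
        -- Here d ≥ 2 enters: 1 - 1/d ≥ 1/2.
        rw [Real.sqrt_eq_rpow]
        refine mul_le_mul_of_nonneg_left (Real.rpow_le_rpow_of_exponent_le hk1 ?_) hC.le
        have : (1 : ℝ) / d ≤ 1 / 2 := by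
          refine one_div_le_one_div_of_le two_pos ?_
          exact_mod_cast hd
        linarith
      have h2 := mul_le_mul_of_nonneg_left h1 hβ.le
      have h3 : Real.sqrt K ≤ Real.sqrt k := Real.sqrt_le_sqrt hkK'
      have h4 : β * s ≤ β * (C * Real.sqrt k / 2) := by
        refine mul_le_mul_of_nonneg_left (hK'.trans ?_) hβ.le
        gcongr
      have h5 : C / 2 * Real.sqrt k ≤ β * (C / 2 * Real.sqrt k) :=
        le_mul_of_one_le_left (by positivity) hβ1
      have h6 : 0 ≤ (K : ℝ) * |a| * Real.log β := by positivity
      have h7 : 0 ≤ (K : ℝ) * (|M| + |D|) + C / 2 * Real.sqrt K := by positivity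
      linarith
  have hnn : ∀ k : ℕ+, 0 ≤ (k : ℝ) * r k / ρ := fun k =>
    div_nonneg (mul_nonneg (by positivity) (hadm.1 k)) hρ0.le
  rw [Real.norm_of_nonneg (tsum_nonneg hnn), Real.norm_of_nonneg (Real.exp_pos _).le]
  set W : ℝ := Real.exp (-(β * (s - ν)) + K * |a| * Real.log β) with hW
  have hWρ : W * ρ = Real.exp (-(β * s) + K * |a| * Real.log β) := by
    rw [hW, hρ, ← Real.exp_add]
    congr 1
    ring
  calc ∑' k : ℕ+, (k : ℝ) * r k / ρ
      ≤ ∑' k : ℕ+, Q * W * ((k : ℝ) * Real.exp (-(C / 2 * Real.sqrt k))) := by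
        refine (hadm.2.1.div_const ρ).tsum_le_tsum (fun k => ?_) (hsum.mul_left _)
        rw [div_le_iff₀ hρ0]
        have hk0 : (0 : ℝ) ≤ k := by positivity
        have h := mul_le_mul_of_nonneg_left (hterm k) hk0
        rw [← hWρ] at h
        linarith
    _ = Q * T * W := by
        rw [tsum_mul_left]
        ring

end IdealMixture

theorem mainTheorem7 (d : ℕ) (hd : 1 ≤ d) (v : ℝ≥0 → EReal) (rhc b : ℝ≥0)
    (hv : IdealMixture.PairPotential d v rhc b) (R : ℝ) (hR : (b : ℝ) < R)
    (hHolder : IdealMixture.HolderHypothesis d v rhc)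
    (hShape : IdealMixture.CompactShapeHypothesis d v) :
    -- the limits and the minimiser that enter the definitions exist
    Tendsto (fun k : ℕ+ => IdealMixture.groundE d v k / k) atTop
        (𝓝 (IdealMixture.groundEInf d v)) ∧
    (∀ β : ℝ, 0 < β → Tendsto (IdealMixture.clusterF d v R β) atTop
        (𝓝 (IdealMixture.clusterFInf d v R β))) ∧
    (∀ β ρ : ℝ, 0 < β → 0 < ρ → ∃! r : ℕ+ → ℝ, IdealMixture.IsIdealMinimiser d v R β ρ r) ∧
    -- the case `ν > ν*`
    (∀ ν : ℝ, IdealMixture.nuStar d v < ν → ν ∉ IdealMixture.kinks d v →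
      ∃ k : ℕ+, (∀ j : ℕ+, IdealMixture.muNu d v ν = (IdealMixture.groundE d v j - ν) / j ↔ j = k) ∧
        0 < IdealMixture.gap d v ν k ∧
        (fun β : ℝ => k * IdealMixture.idealMinimiser d v R β (Real.exp (-(β * ν))) k
            / Real.exp (-(β * ν)) - 1)
          =O[atTop] fun β : ℝ => Real.exp (-(β * IdealMixture.gap d v ν k / 2))) ∧
    -- the case `ν < ν*`
    (2 ≤ d → IdealMixture.SurfaceHypothesis d v R →
      (∀ k : ℕ+, ∃ x : Fin k → IdealMixture.Space d, IdealMixture.IsGroundState v x) →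
      ∀ ν : ℝ, 0 < ν → ν < IdealMixture.nuStar d v →
      ∃ g : ℝ → ℝ, g =O[atTop] Real.log ∧
        (fun β : ℝ => ∑' k : ℕ+,
            k * IdealMixture.idealMinimiser d v R β (Real.exp (-(β * ν))) k
              / Real.exp (-(β * ν)))
          =O[atTop] fun β : ℝ => Real.exp (-(β * (IdealMixture.nuStar d v - ν)) + g β)) := by
  -- A coordinate direction along which particles are ordered and clusters moved.
  have o : Fin d := ⟨0, hd⟩
  refine ⟨(IdealMixture.tendsto_groundE_div hv o).1,
    fun β hβ => IdealMixture.tendsto_clusterF hv o hR hβ, fun β ρ hβ hρ => ?_,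
    fun ν hν hk => ?_, fun hd2 hS hgs ν _ _ => IdealMixture.isBigO_gas hv o hd2 hR hHolder hS hgs ν⟩
  · obtain ⟨-, -, r, hr, huniq, -⟩ := IdealMixture.exists_isIdealMinimiser hβ hρ
      (IdealMixture.tendsto_clusterF hv o hR hβ)
    exact ⟨r, hr, huniq⟩
  · obtain ⟨hlt, k, hiff, hgap, hle⟩ := IdealMixture.exists_muNu_eq_line hv o hν hk
    exact ⟨k, hiff, hgap,
      IdealMixture.isBigO_supersaturated hv o hR hlt ((hiff k).2 rfl) hgap hle⟩
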